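/- Conventions. Let $V$ be a finite-dimensional vector space over a field $\mathbb K$, let $S=S(V^*)$ be the algebra of polynomial functions on $V$, and let $\mathrm{Der}(S)$ be the $S$-module of $\mathbb K$-derivations of $S$. A derivation $\theta$ is homogeneous of polynomial degree $p$ (written $\mathrm{pdeg}\,\theta=p$) if $\theta(\alpha)$ is $0$ or homogeneous of degree $p$ for every $\alpha\in V^*$. A multiarrangement $(\mathcal A,\nu)$ in $V$ is a finite set $\mathcal A$ of linear hyperplanes $H=\ker\alpha_H$ of $V$ with multiplicities $\nu(H)\ge 1$; its defining polynomial is $Q(\mathcal A,\nu)=\prod_{H\in\mathcal A}\alpha_H^{\nu(H)}$ (up to a nonzero constant). Put $$D(\mathcal A,\nu)=\{\theta\in\mathrm{Der}(S)\mid\theta(\alpha_H)\in\alpha_H^{\nu(H)}S\text{ for all }H\in\mathcal A\}.$$ If this $S$-module is free, it has a homogeneous basis, and the multiset of polynomial degrees of such a basis is denoted $\exp(\mathcal A,\nu)$ (the exponents). For $H_0=\ker\alpha_0\in\mathcal A$, the deletion $(\mathcal A',\nu')$ arises by lowering the multiplicity of $H_0$ by one (removing $H_0$ if $\nu(H_0)=1$).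 The restriction $(\mathcal A'',\nu^*)$ is the multiarrangement in $H_0$ with $\mathcal A''=\{H\cap H_0\mid H\in\mathcal A\setminus\{H_0\}\}$ and the Euler multiplicity $\nu^*$: for $Y\in\mathcal A''$ let $\mathcal A_Y=\{H\in\mathcal A\mid Y\subseteq H\}$ and $\nu_Y=\nu|_{\mathcal A_Y}$; the module $D(\mathcal A_Y,\nu_Y)$ has a homogeneous basis $\theta_Y,\psi_Y,D_3,\dots,D_{\dim V}$ in which $D_3,\dots,D_{\dim V}$ are the constant derivations in the directions of a basis of $Y$, $\theta_Y\notin\alpha_0\mathrm{Der}(S)$ and $\psi_Y\in\alpha_0\mathrm{Der}(S)$, and $\nu^*(Y)=\mathrm{pdeg}\,\theta_Y$. The class of inductively free multiarrangements is the smallest class that contains the empty arrangement in every finite-dimensional space and contains $(\mathcal A,\nu)$ whenever there is $H_0\in\mathcal A$ such that $(\mathcal A',\nu')$ and $(\mathcal A'',\nu^*)$ belong to the class and $\exp(\mathcal A'',\nu^*)\subseteq\exp(\mathcal A',\nu')$ as multisets. Theorem. Let $\ell$ and $m\ge 1$ be integers, $\ell\ge 0$. Let $\mathcal B_\ell=\{\ker(x_i-x_j)\mid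 1\le i<j\le\ell\}$ be the braid arrangement in $\mathbb C^\ell$, and let $\mathcal A_{\ell-1}$ be the Coxeter arrangement of type $A_{\ell-1}$, that is, the arrangement of the hyperplanes $x_i=x_j$, $1\le i<j\le\ell$, in the space $\{x\in\mathbb C^\ell\mid x_1+\dots+x_\ell=0\}$. Then the multiarrangement $(\mathcal B_\ell,m)$ with constant multiplicity $m$, whose defining polynomial is $$Q(\mathcal B_\ell,m)=\prod_{1\le i<j\le\ell}(x_i-x_j)^m,$$ is inductively free, and so is the multiarrangement $(\mathcal A_{\ell-1},m)$ with constant multiplicity $m$. Moreover $(\mathcal A_{\ell-1},m)$ is free with exponents $$\exp(\mathcal A_{\ell-1},m)=\left\{\tfrac{m\ell}{2},\dots,\tfrac{m\ell}{2}\right\}\quad(\ell-1\text{ copies})$$ if $m$ is even, and $$\exp(\mathcal A_{\ell-1},m)=\left\{\tfrac{(m-1)\ell}{2}+1,\tfrac{(m-1)\ell}{2}+2,\dots,\tfrac{(m-1)\ell}{2}+\ell-1\right\}$$ if $m$ is odd; for $\ell\le 1$ both multisets are empty. -/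

import Mathlib

open Module

universe u v

/-- `S = S(V*)`, the symmetric algebra of the dual space, i.e. the polynomial functions on `V`. -/
abbrev PolyRing (K : Type u) (V : Type v) [Field K] [AddCommGroup V] [Module K V] :=
  SymmetricAlgebra K (Dual K V)

/-- A linear form on `V`, seen as an element of degree one of `S`. -/
noncomputable abbrev linForm {K : Type u} {V : Type v} [Field K] [AddCommGroup V] [Module K V]
    (α : Dual K V) : PolyRing K V :=
  SymmetricAlgebra.ι K (Dual K V) α

/-- `S_p`, the homogeneous elements of degree `p` (with `0`): the span of the products of
`p` linear forms. -/
noncomputable def homogeneousPart (K : Type u) (V : Type v) [Field K] [AddCommGroup V]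
    [Module K V] (p : ℕ) : Submodule K (PolyRing K V) :=
  LinearMap.range (SymmetricAlgebra.ι K (Dual K V)) ^ p

/-- `Der(S)`, the `S`-module of `K`-derivations of `S`. -/
abbrev PolyDer (K : Type u) (V : Type v) [Field K] [AddCommGroup V] [Module K V] :=
  Derivation K (PolyRing K V) (PolyRing K V)

/-- `θ = ∑ fᵢ ∂/∂xᵢ` is homogeneous of polynomial degree `p`: each `fᵢ = θ(xᵢ)`, hence each value
of `θ` on a linear form, lies in `S_p`. -/
def HasPdeg {K : Type u} {V : Type v} [Field K] [AddCommGroup V] [Module K V]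
    (θ : PolyDer K V) (p : ℕ) : Prop :=
  ∀ α : Dual K V, θ (linForm α) ∈ homogeneousPart K V p

/-- A (central) multiarrangement `(𝒜, ν)` in `V`, seen as a finite multiset of linear
hyperplanes: `mult H` is the multiplicity of `H`, and `𝒜` is the set of all `H` with
`mult H ≠ 0`. The linear hyperplanes are the coatoms in the lattice of subspaces. -/
@[ext]
structure Multiarrangement (K : Type u) (V : Type v) [Field K] [AddCommGroup V] [Module K V] where
  mult : Submodule K V → ℕ
  finite_support : (Function.support mult).Finite
  isCoatom : ∀ H, mult H ≠ 0 → IsCoatom H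

namespace Multiarrangement

section Basic

variable {K : Type u} {V : Type v} [Field K] [AddCommGroup V] [Module K V]

/-- The underlying simple arrangement `𝒜`. -/
def hyperplanes (A : Multiarrangement K V) : Set (Submodule K V) :=
  {H | A.mult H ≠ 0}

/-- The empty arrangement in `V`. -/
def empty (K : Type u) (V : Type v) [Field K] [AddCommGroup V] [Module K V] :
    Multiarrangement K V where
  mult _ := 0
  finite_support := by simp [Function.support]
  isCoatom _ h := absurd rfl h

open Classical in
/-- The arrangement `{ker αᵢ}` given by a finite family of nonzero linear forms, with constant
multiplicity `m`. -/
noncomputable def ofForms {ι : Type*} [Finite ι] (α : ι → Dual K V) (hα : ∀ i, α i ≠ 0) (m : ℕ) :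
    Multiarrangement K V where
  mult H := if H ∈ Set.range (fun i => LinearMap.ker (α i)) then m else 0
  finite_support := by
    refine (Set.finite_range (fun i => LinearMap.ker (α i))).subset fun H hH => ?_
    by_contra h
    exact hH (if_neg h)
  isCoatom H hH := by
    have h : H ∈ Set.range (fun i => LinearMap.ker (α i)) := by
      by_contra h
      exact hH (if_neg h)
    obtain ⟨i, rfl⟩ := h
    exact LinearMap.isCoatom_ker_of_surjective (LinearMap.surjective (hα i))

/-- `Q` is a defining polynomial of `(𝒜, ν)`: the product of the `α_H ^ ν(H)`, for some choice of
linear forms `α_H` with `ker α_H = H`. -/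
def IsDefiningPolynomial (A : Multiarrangement K V) (Q : PolyRing K V) : Prop :=
  ∃ α : Submodule K V → Dual K V, (∀ H ∈ A.hyperplanes, LinearMap.ker (α H) = H) ∧
    Q = ∏ H ∈ A.finite_support.toFinset, linForm (α H) ^ A.mult H

/-- The module of derivations `D(𝒜, ν)`: all `θ` with `θ(α_H) ∈ α_H ^ ν(H) S` for `H ∈ 𝒜`. -/
def derivations (A : Multiarrangement K V) : Submodule (PolyRing K V) (PolyDer K V) where
  carrier := {θ | ∀ H ∈ A.hyperplanes, ∀ α : Dual K V, LinearMap.ker α = H →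
    linForm α ^ A.mult H ∣ θ (linForm α)}
  add_mem' ha hb H hH α hα := by
    rw [Derivation.add_apply]
    exact dvd_add (ha H hH α hα) (hb H hH α hα)
  zero_mem' H hH α hα := by
    rw [Derivation.zero_apply]
    exact dvd_zero _
  smul_mem' c θ hθ H hH α hα := by
    rw [Derivation.smul_apply, smul_eq_mul]
    exact (hθ H hH α hα).mul_left c

/-- `(𝒜, ν)` is free with multiset of exponents `E`: the `S`-module `D(𝒜, ν)` has a basis of
homogeneous derivations, whose polynomial degrees form `E`. -/
def HasExponents (A : Multiarrangement K V) (E : Multiset ℕ) : Prop :=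
  ∃ (n : ℕ) (b : Basis (Fin n) (PolyRing K V) A.derivations) (d : Fin n → ℕ),
    (∀ i, HasPdeg (b i : PolyDer K V) (d i)) ∧ E = Finset.univ.val.map d

open Classical in
/-- The localization `(𝒜_Y, ν_Y)`: the hyperplanes that contain `Y`. -/
noncomputable def localization (A : Multiarrangement K V) (Y : Submodule K V) :
    Multiarrangement K V where
  mult H := if Y ≤ H then A.mult H else 0
  finite_support := by
    refine A.finite_support.subset fun H hH h => hH ?_
    simp [h]
  isCoatom H hH := A.isCoatom H fun h => hH (by simp [h])

open Classical in
/-- The deletion `(𝒜', ν')` with respect to `H₀ ∈ 𝒜`: the multiplicity of `H₀` drops by one, so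
that `H₀` leaves the arrangement if its multiplicity was one. -/
noncomputable def deletion (A : Multiarrangement K V) (H₀ : Submodule K V) :
    Multiarrangement K V where
  mult H := if H = H₀ then A.mult H - 1 else A.mult H
  finite_support := by
    refine A.finite_support.subset fun H hH h => hH ?_
    simp [h]
  isCoatom H hH := A.isCoatom H fun h => hH (by simp [h])

/-- `ν*(Y) = d`, for the Euler multiplicity `ν*` with respect to `H₀ = ker α₀`, where `Y` is a
subspace of `V` of the form `H ∩ H₀`: the module `D(𝒜_Y, ν_Y)` has a homogeneous basis
`θ, ψ, D₃, …, D_ℓ` with `θ ∉ α₀ Der(S)`, `ψ ∈ α₀ Der(S)` and `pdeg θ = d`.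
Here `D₃, …, D_ℓ` are the partial derivatives in the directions of a basis `y` of `Y`, i.e. the
derivations that send a linear form `α` to the constants `α(y i)`. -/
def IsEulerMultiplicity (A : Multiarrangement K V) (H₀ Y : Submodule K V) (d : ℕ) : Prop :=
  ∃ (α₀ : Dual K V) (n : ℕ) (y : Basis (Fin n) K Y)
    (b : Basis (Fin 2 ⊕ Fin n) (PolyRing K V) (A.localization Y).derivations) (e : ℕ),
    LinearMap.ker α₀ = H₀ ∧
    HasPdeg (b (Sum.inl 0) : PolyDer K V) d ∧
    HasPdeg (b (Sum.inl 1) : PolyDer K V) e ∧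
    (∀ i, ∀ α : Dual K V, (b (Sum.inr i) : PolyDer K V) (linForm α) =
      algebraMap K (PolyRing K V) (α (y i : V))) ∧
    (¬ ∃ η : PolyDer K V, (b (Sum.inl 0) : PolyDer K V) = linForm α₀ • η) ∧
    (∃ η : PolyDer K V, (b (Sum.inl 1) : PolyDer K V) = linForm α₀ • η)

/-- `R`, a multiarrangement in the vector space `H₀`, is the restriction `(𝒜'', ν*)` of `(𝒜, ν)`
with respect to `H₀`: its hyperplanes are the `H ∩ H₀` for `H ∈ 𝒜 \ {H₀}`, and its multiplicity
is the Euler multiplicity. -/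
def IsRestriction (A : Multiarrangement K V) (H₀ : Submodule K V) (R : Multiarrangement K H₀) :
    Prop :=
  R.hyperplanes = {Y | ∃ H ∈ A.hyperplanes, H ≠ H₀ ∧ Y = H.comap H₀.subtype} ∧
  ∀ Y ∈ R.hyperplanes, A.IsEulerMultiplicity H₀ (Y.map H₀.subtype) (R.mult Y)

end Basic

/-- The class of inductively free multiarrangements: the smallest class that contains the empty
arrangement in each finite-dimensional space, and `(𝒜, ν)` whenever, for some `H₀ ∈ 𝒜`, the
deletion and the restriction belong to the class and the exponents of the restriction are
contained (as a multiset) in those of the deletion. -/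
inductive InductivelyFree (K : Type u) [Field K] :
    (V : Type v) → [AddCommGroup V] → [Module K V] → Multiarrangement K V → Prop
  | empty (V : Type v) [AddCommGroup V] [Module K V] [FiniteDimensional K V] :
      InductivelyFree K V (Multiarrangement.empty K V)
  | addition (V : Type v) [AddCommGroup V] [Module K V] (A : Multiarrangement K V)
      (H₀ : Submodule K V) (hH₀ : H₀ ∈ A.hyperplanes)
      (R : Multiarrangement K H₀) (hR : A.IsRestriction H₀ R)
      (h' : InductivelyFree K V (A.deletion H₀)) (h'' : InductivelyFree K H₀ R)
      (E' E'' : Multiset ℕ) (hE' : (A.deletion H₀).HasExponents E') (hE'' : R.HasExponents E'')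
      (hE : E'' ≤ E') :
      InductivelyFree K V A

end Multiarrangement

/-- The pairs `(i, j)` with `i < j`. -/
abbrev BraidIndex (ℓ : ℕ) := {p : Fin ℓ × Fin ℓ // p.1 < p.2}

/-- The coordinate function `x_i` on `ℂ^ℓ`. -/
noncomputable def coordForm (ℓ : ℕ) (i : Fin ℓ) : Dual ℂ (Fin ℓ → ℂ) :=
  LinearMap.proj i

/-- The linear form `x_i - x_j` on `ℂ^ℓ`. -/
noncomputable def braidForm (ℓ : ℕ) (p : BraidIndex ℓ) : Dual ℂ (Fin ℓ → ℂ) :=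
  coordForm ℓ p.1.1 - coordForm ℓ p.1.2

/-- The hyperplane `x_1 + ⋯ + x_ℓ = 0` in `ℂ^ℓ`, on which the symmetric group, the Coxeter group
of type `A_{ℓ-1}`, acts by its reflection representation. -/
noncomputable def sumZero (ℓ : ℕ) : Submodule ℂ (Fin ℓ → ℂ) :=
  LinearMap.ker (∑ i, coordForm ℓ i)

/-- The restriction of `x_i - x_j` to `sumZero ℓ`. -/
noncomputable def coxeterForm (ℓ : ℕ) (p : BraidIndex ℓ) : Dual ℂ (sumZero ℓ) :=
  braidForm ℓ p ∘ₗ (sumZero ℓ).subtype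

theorem coxeterForm_ne_zero (ℓ : ℕ) (p : BraidIndex ℓ) : coxeterForm ℓ p ≠ 0 := by
  obtain ⟨⟨i, j⟩, hij⟩ := p
  have hij : i ≠ j := ne_of_lt hij
  intro h
  have hmem : (Pi.single i 1 - Pi.single j 1 : Fin ℓ → ℂ) ∈ sumZero ℓ := by
    simp [sumZero, coordForm, LinearMap.sum_apply]
  have h2 := LinearMap.congr_fun h ⟨_, hmem⟩
  simp [coxeterForm, braidForm, coordForm, hij, hij.symm] at h2

theorem braidForm_ne_zero (ℓ : ℕ) (p : BraidIndex ℓ) : braidForm ℓ p ≠ 0 := by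
  intro h
  exact coxeterForm_ne_zero ℓ p (by simp [coxeterForm, h])

/-- `(ℬ_ℓ, m)`: the braid arrangement in `ℂ^ℓ` with constant multiplicity `m`. -/
noncomputable def braidMulti (ℓ m : ℕ) : Multiarrangement ℂ (Fin ℓ → ℂ) :=
  .ofForms (braidForm ℓ) (braidForm_ne_zero ℓ) m

/-- `(𝒜_{ℓ-1}, m)`: the Coxeter arrangement of type `A_{ℓ-1}`, in its space of dimension `ℓ - 1`,
with constant multiplicity `m`. -/
noncomputable def coxeterAMulti (ℓ m : ℕ) : Multiarrangement ℂ (sumZero ℓ) :=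
  .ofForms (coxeterForm ℓ) (coxeterForm_ne_zero ℓ) m

/-! Constant multiplicities are not preserved by deletion or restriction, so the induction runs over
a larger family: multiplicity n_i + n_j + [ij is an edge of G] on x_i = x_j, for vertex weights n
and a graph G with a perfect elimination ordering. With N = ∑ n_i, the exponents are N plus the
number of earlier neighbours of each vertex, with one copy of N (that of the first vertex) left out,
together with a zero for each constant derivation along the common center. The value m = 2k is n = k
with G empty, and m = 2k + 1 is n = k with G complete.

Let v be the last vertex that has an earlier neighbour, and k a neighbour of v. All neighbours of v
are then earlier and form a clique. Deletion at x_v = x_k removes the edge vk. Restriction merges v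
into k: the weight of k becomes n_k + n_v, and G is kept on the remaining vertices. If d is N plus
the number of the other neighbours of v, the exponents are d, T for the deletion, T for the
restriction and d + 1, T for the arrangement itself. If there is no edge and some n_i is positive,
the same multiplicities arise from n_i - 1 and the star centered at i, with a smaller N. If there is
no edge and n = 0, the arrangement is empty.

The algebra behind the edge step (`exists_basis_of_deletion`) concerns α = x_v - x_k and μ = n_v +
n_k. For θ in the module of the deletion, θ(α) / α^μ is modulo α a multiple of B = ∏ (x_k -
x_s)^(n_s + [vs is an edge]). This is checked on one triangle v, k, s at a time, by differentiation
(`exists_eq_of_pow_mul_sub_pow_mul`). Conversely some φ attains B up to a nonzero constant: φ(x_i) =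
P(x_i), where P is an antiderivative of a product of powers of the t - x_s and the constant is a
Beta integral (`exists_eval_sub_eval_eq`); for n_v = 0 a derivation that moves x_v alone suffices.
Hence some basis member of degree μ + deg B has a nonzero constant as its coefficient of B.
Multiplying it by α and correcting the others by its multiples gives a basis for the arrangement.
The same step on the three vertices v, k, s yields the Euler multiplicities
(`isEulerMultiplicity_of_triangle`), which are the weights of the merged graph. -/

namespace PolyRing

/-! ### Linear forms as primes of the polynomial ring. -/

variable {K : Type u} {V : Type v} [Field K] [AddCommGroup V] [Module K V]

theorem linForm_injective : Function.Injective (linForm : Dual K V → PolyRing K V) := by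
  intro α β h
  ext w
  have := congrArg (SymmetricAlgebra.lift (Dual.eval K V w)) h
  simpa using this

theorem linForm_ne_zero {α : Dual K V} (hα : α ≠ 0) : linForm α ≠ 0 := fun h =>
  hα (linForm_injective (h.trans (map_zero _).symm))

theorem linForm_sub (α β : Dual K V) : linForm (α - β) = linForm α - linForm β := map_sub _ _ _

theorem linForm_smul (c : K) (α : Dual K V) :
    linForm (c • α) = algebraMap K (PolyRing K V) c * linForm α := by
  rw [linForm, map_smul, Algebra.smul_def]

instance : UniqueFactorizationMonoid (PolyRing K V) :=
  (SymmetricAlgebra.equivMvPolynomial (Basis.ofVectorSpace K (Dual K V))).symm.toMulEquiv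
    |>.uniqueFactorizationMonoid inferInstance

/-- Substitution of `z - α(z) w` for `z`: if `α w = 1`, the pullback along the projection to
`ker α` in the direction `w`. -/
noncomputable def projectHom (α : Dual K V) (w : V) : PolyRing K V →ₐ[K] PolyRing K V :=
  SymmetricAlgebra.lift
    (SymmetricAlgebra.ι K (Dual K V) ∘ₗ (LinearMap.id - (Dual.eval K V w).smulRight α))

theorem projectHom_linForm (α β : Dual K V) (w : V) :
    projectHom α w (linForm β) = linForm (β - β w • α) := by
  simp [projectHom, linForm]

/-- Modulo α the substitution fixes every linear form, hence every polynomial. -/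
theorem dvd_projectHom_sub (α : Dual K V) (w : V) (p : PolyRing K V) :
    linForm α ∣ projectHom α w p - p := by
  rw [← Ideal.mem_span_singleton, ← Ideal.Quotient.mk_eq_mk_iff_sub_mem]
  have : (Ideal.Quotient.mkₐ K (Ideal.span {linForm α})).comp (projectHom α w) =
      Ideal.Quotient.mkₐ K (Ideal.span {linForm α}) := by
    apply SymmetricAlgebra.algHom_ext
    ext β
    change Ideal.Quotient.mk _ (projectHom α w (linForm β)) = Ideal.Quotient.mk _ (linForm β)
    rw [projectHom_linForm, Ideal.Quotient.mk_eq_mk_iff_sub_mem, Ideal.mem_span_singleton,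
      ← linForm_sub,
      show β - β w • α - β = (-(β w)) • α from LinearMap.ext fun z => by simp, linForm_smul]
    exact dvd_mul_left _ _
  exact DFunLike.congr_fun this p

theorem linForm_dvd_iff {α : Dual K V} {w : V} (h : α w = 1) {p : PolyRing K V} :
    linForm α ∣ p ↔ projectHom α w p = 0 := by
  constructor
  · rintro ⟨q, rfl⟩
    rw [map_mul, projectHom_linForm, h, one_smul, sub_self, linForm, map_zero, zero_mul]
  · intro hp
    have := dvd_projectHom_sub α w p
    rwa [hp, zero_sub, dvd_neg] at this

theorem exists_apply_eq_one {α : Dual K V} (hα : α ≠ 0) : ∃ w, α w = 1 :=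
  LinearMap.surjective hα 1

/-- The multiples of α are the kernel of a ring homomorphism into a domain. -/
theorem prime_linForm {α : Dual K V} (hα : α ≠ 0) : Prime (linForm α) := by
  obtain ⟨w, hw⟩ := exists_apply_eq_one hα
  refine ⟨linForm_ne_zero hα, ?_, ?_⟩
  · intro h
    have : linForm α ∣ 1 := h.dvd
    rw [linForm_dvd_iff hw, map_one] at this
    exact one_ne_zero this
  · intro a b
    simp only [linForm_dvd_iff hw, map_mul, mul_eq_zero, imp_self]

theorem linForm_dvd_linForm {α β : Dual K V} (hα : α ≠ 0) (h : linForm α ∣ linForm β) :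
    ∃ c : K, β = c • α := by
  obtain ⟨w, hw⟩ := exists_apply_eq_one hα
  rw [linForm_dvd_iff hw, projectHom_linForm] at h
  refine ⟨β w, sub_eq_zero.1 (linForm_injective (h.trans (map_zero _).symm))⟩

theorem eq_smul_of_ker_eq {α β : Dual K V} (h : LinearMap.ker α = LinearMap.ker β) (hα : α ≠ 0) :
    ∃ c : K, c ≠ 0 ∧ β = c • α := by
  obtain ⟨w, hw⟩ := exists_apply_eq_one hα
  have hβ : β = β w • α := by
    ext z
    have : z - α z • w ∈ LinearMap.ker β := by
      rw [← h]; simp [hw]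
    have := sub_eq_zero.1 ((map_sub β _ _).symm.trans this)
    rw [this]
    simp [mul_comm]
  refine ⟨β w, ?_, hβ⟩
  intro h0
  have : w ∈ LinearMap.ker α := by rw [h]; exact h0
  rw [LinearMap.mem_ker, hw] at this
  exact one_ne_zero this

theorem isRelPrime_linForm {α β : Dual K V} (hα : α ≠ 0) (h : ∀ c : K, β ≠ c • α) :
    IsRelPrime (linForm α) (linForm β) := by
  rw [(prime_linForm hα).irreducible.isRelPrime_iff_not_dvd]
  intro hd
  obtain ⟨c, hc⟩ := linForm_dvd_linForm hα hd
  exact h c hc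

/-! ### Homogeneous components. -/

section Grading

/-- Scaling of the linear forms by a variable. -/
noncomputable def scaleHom (K : Type u) (V : Type v) [Field K] [AddCommGroup V] [Module K V] :
    PolyRing K V →ₐ[K] Polynomial (PolyRing K V) :=
  SymmetricAlgebra.lift
    ((LinearMap.mulLeft K (Polynomial.X : Polynomial (PolyRing K V))) ∘ₗ
      (Polynomial.CAlgHom (R := K) (A := PolyRing K V)).toLinearMap ∘ₗ
        SymmetricAlgebra.ι K (Dual K V))

theorem scaleHom_linForm (α : Dual K V) :
    scaleHom K V (linForm α) = Polynomial.X * Polynomial.C (linForm α) := by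
  simp [scaleHom]

theorem scaleHom_of_mem {p : PolyRing K V} {d : ℕ} (hp : p ∈ homogeneousPart K V d) :
    scaleHom K V p = Polynomial.X ^ d * Polynomial.C p := by
  unfold homogeneousPart at hp
  induction hp using Submodule.pow_induction_on_left' with
  | algebraMap r =>
    rw [AlgHom.commutes, pow_zero, one_mul]; rfl
  | add x y i hx hy h1 h2 => rw [map_add, h1, h2, map_add, mul_add]
  | mem_mul m hm i x hx ih =>
    obtain ⟨α, rfl⟩ := hm
    rw [map_mul, ih, map_mul, pow_succ]
    have := scaleHom_linForm α
    rw [linForm] at this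
    rw [this]
    ring

/-- The homogeneous component of degree `d`. -/
noncomputable def component (d : ℕ) : PolyRing K V →ₗ[K] PolyRing K V :=
  ((Polynomial.lcoeff (PolyRing K V) d).restrictScalars K) ∘ₗ (scaleHom K V).toLinearMap

theorem component_apply (d : ℕ) (p : PolyRing K V) :
    component d p = (scaleHom K V p).coeff d := rfl

theorem component_mul_of_mem {p : PolyRing K V} {d : ℕ} (hp : p ∈ homogeneousPart K V d)
    (q : PolyRing K V) (e : ℕ) : component (d + e) (p * q) = p * component e q := by
  rw [component_apply, component_apply, map_mul, scaleHom_of_mem hp, mul_assoc, add_comm,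
    Polynomial.coeff_X_pow_mul, Polynomial.coeff_C_mul]

theorem component_mul_of_mem_of_lt {p : PolyRing K V} {d : ℕ} (hp : p ∈ homogeneousPart K V d)
    (q : PolyRing K V) {e : ℕ} (he : e < d) : component e (p * q) = 0 := by
  rw [component_apply, map_mul, scaleHom_of_mem hp, mul_assoc, Polynomial.coeff_X_pow_mul']
  simp [he]

theorem component_of_mem {p : PolyRing K V} {d : ℕ} (hp : p ∈ homogeneousPart K V d) :
    component d p = p := by
  rw [component_apply, scaleHom_of_mem hp]
  simp

theorem one_mem_homogeneousPart : (1 : PolyRing K V) ∈ homogeneousPart K V 0 := by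
  rw [homogeneousPart, pow_zero]
  exact Submodule.one_le.mp le_rfl

theorem algebraMap_mem_homogeneousPart (c : K) :
    algebraMap K (PolyRing K V) c ∈ homogeneousPart K V 0 := by
  rw [Algebra.algebraMap_eq_smul_one]
  exact Submodule.smul_mem _ _ one_mem_homogeneousPart

theorem linForm_mem_homogeneousPart (α : Dual K V) : linForm α ∈ homogeneousPart K V 1 := by
  rw [homogeneousPart, pow_one]
  exact ⟨α, rfl⟩

theorem mul_mem_homogeneousPart {p q : PolyRing K V} {d e : ℕ} (hp : p ∈ homogeneousPart K V d)
    (hq : q ∈ homogeneousPart K V e) : p * q ∈ homogeneousPart K V (d + e) := by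
  rw [homogeneousPart, pow_add]
  exact Submodule.mul_mem_mul hp hq

theorem pow_mem_homogeneousPart {p : PolyRing K V} {d : ℕ} (hp : p ∈ homogeneousPart K V d)
    (n : ℕ) : p ^ n ∈ homogeneousPart K V (n * d) := by
  induction n with
  | zero => simpa using one_mem_homogeneousPart
  | succ n ih =>
    rw [pow_succ, Nat.succ_mul]
    exact mul_mem_homogeneousPart ih hp

theorem prod_mem_homogeneousPart {ι : Type*} (s : Finset ι) (f : ι → PolyRing K V) (d : ι → ℕ)
    (h : ∀ i ∈ s, f i ∈ homogeneousPart K V (d i)) :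
    ∏ i ∈ s, f i ∈ homogeneousPart K V (∑ i ∈ s, d i) := by
  classical
  induction s using Finset.induction_on with
  | empty => simpa using one_mem_homogeneousPart
  | insert a s ha ih =>
    rw [Finset.prod_insert ha, Finset.sum_insert ha]
    exact mul_mem_homogeneousPart (h a (by simp))
      (ih fun i hi => h i (Finset.mem_insert_of_mem hi))

theorem component_mem (d : ℕ) (p : PolyRing K V) : component d p ∈ homogeneousPart K V d := by
  induction p using SymmetricAlgebra.induction generalizing d with
  | algebraMap r =>
    rw [component_apply, scaleHom_of_mem (algebraMap_mem_homogeneousPart r), pow_zero, one_mul,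
      Polynomial.coeff_C]
    split_ifs with h
    · rw [h]; exact algebraMap_mem_homogeneousPart r
    · exact Submodule.zero_mem _
  | ι α =>
    rw [component_apply, scaleHom_of_mem (linForm_mem_homogeneousPart α), pow_one,
      Polynomial.X_mul_C, Polynomial.coeff_C_mul, Polynomial.coeff_X]
    split_ifs with h
    · rw [mul_one, ← h]; exact linForm_mem_homogeneousPart α
    · rw [mul_zero]; exact Submodule.zero_mem _
  | mul a b ha hb =>
    rw [component_apply, map_mul, Polynomial.coeff_mul]
    refine Submodule.sum_mem _ fun x hx => ?_
    rw [← Finset.HasAntidiagonal.mem_antidiagonal.1 hx]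
    exact mul_mem_homogeneousPart (ha _) (hb _)
  | add a b ha hb =>
    rw [map_add]
    exact Submodule.add_mem _ (ha d) (hb d)

/-- The value at the origin. -/
noncomputable abbrev constantCoeff : PolyRing K V →ₐ[K] K := SymmetricAlgebra.algebraMapInv

theorem constantCoeff_linForm (α : Dual K V) : constantCoeff (linForm α) = 0 :=
  SymmetricAlgebra.algebraMapInv_ι α

theorem constantCoeff_eq_zero {p : PolyRing K V} {d : ℕ} (hp : p ∈ homogeneousPart K V d)
    (hd : d ≠ 0) : constantCoeff p = 0 := by
  unfold homogeneousPart at hp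
  induction hp using Submodule.pow_induction_on_left' with
  | algebraMap r => exact absurd rfl hd
  | add x y i hx hy h1 h2 => rw [map_add, h1 hd, h2 hd, add_zero]
  | mem_mul m hm i x hx ih =>
    obtain ⟨α, rfl⟩ := hm
    rw [map_mul, SymmetricAlgebra.algebraMapInv_ι, zero_mul]

theorem eq_algebraMap_of_mem {p : PolyRing K V} (hp : p ∈ homogeneousPart K V 0) :
    p = algebraMap K _ (constantCoeff p) := by
  rw [homogeneousPart, pow_zero, Submodule.mem_one] at hp
  obtain ⟨c, rfl⟩ := hp
  simp

end Grading

/-! ### Derivations given by their values on linear forms. -/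

section Derivations

/-- The derivation with prescribed values on linear forms. -/
noncomputable def derivationOfLinear (f : Dual K V →ₗ[K] PolyRing K V) : PolyDer K V :=
  let F : PolyRing K V →ₐ[K] TrivSqZeroExt (PolyRing K V) (PolyRing K V) :=
    SymmetricAlgebra.lift
      ((TrivSqZeroExt.inlAlgHom K (PolyRing K V) (PolyRing K V)).toLinearMap ∘ₗ
        SymmetricAlgebra.ι K (Dual K V) +
        (TrivSqZeroExt.inrHom (PolyRing K V) (PolyRing K V)).restrictScalars K ∘ₗ f)
  have hF : ∀ p, (F p).fst = p := fun p => by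
    have : (TrivSqZeroExt.fstHom K (PolyRing K V) (PolyRing K V)).comp F = AlgHom.id K _ := by
      apply SymmetricAlgebra.algHom_ext
      ext α
      simp [F]
    exact DFunLike.congr_fun this p
  Derivation.mk'
    { toFun := fun p => (F p).snd
      map_add' := fun p q => by simp
      map_smul' := fun c p => by simp } fun p q => by
    simp [hF, mul_comm]

@[simp]
theorem derivationOfLinear_linForm (f : Dual K V →ₗ[K] PolyRing K V) (α : Dual K V) :
    derivationOfLinear f (linForm α) = f α := by
  simp [derivationOfLinear]

theorem derivation_ext {θ η : PolyDer K V} (h : ∀ α, θ (linForm α) = η (linForm α)) : θ = η := by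
  ext p
  induction p using SymmetricAlgebra.induction with
  | algebraMap r => simp
  | ι α => exact h α
  | mul a b ha hb => rw [Derivation.leibniz, Derivation.leibniz, ha, hb]
  | add a b ha hb => rw [map_add, map_add, ha, hb]

/-- The constant derivation in the direction `w`. -/
noncomputable def directional (w : V) : PolyDer K V :=
  derivationOfLinear ((Algebra.linearMap K (PolyRing K V)) ∘ₗ Dual.eval K V w)

@[simp]
theorem directional_linForm (w : V) (α : Dual K V) :
    directional w (linForm α) = algebraMap K (PolyRing K V) (α w) := by
  simp [directional]

end Derivations

end PolyRing

/-- The family `v` is a basis of the submodule `N`. -/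
structure IsBasisOf {R M J : Type*} [Semiring R] [AddCommMonoid M] [Module R M] (v : J → M)
    (N : Submodule R M) : Prop where
  linearIndependent : LinearIndependent R v
  span_eq : Submodule.span R (Set.range v) = N

/-! ### Exchange of a basis member. -/

namespace IsBasisOf

section

variable {R M J : Type*} [CommRing R] [AddCommGroup M] [Module R M] {v : J → M}
  {N : Submodule R M}

theorem exists_basis (h : IsBasisOf v N) : ∃ b : Basis J R N, ∀ j, (b j : M) = v j := by
  refine ⟨(Basis.span h.linearIndependent).map (LinearEquiv.ofEq _ _ h.span_eq), fun j => ?_⟩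
  simp [Basis.span_apply]

theorem mem (h : IsBasisOf v N) (j : J) : v j ∈ N := by
  rw [← h.span_eq]
  exact Submodule.subset_span ⟨j, rfl⟩

theorem exists_sum_eq [Fintype J] (h : IsBasisOf v N) {θ : M} (hθ : θ ∈ N) :
    ∃ f : J → R, ∑ j, f j • v j = θ := by
  rw [← h.span_eq] at hθ
  exact (Submodule.mem_span_range_iff_exists_fun R).1 hθ

theorem reindex {J' : Type*} (h : IsBasisOf v N) (e : J' ≃ J) : IsBasisOf (v ∘ e) N :=
  ⟨h.linearIndependent.comp e e.injective, by rw [e.surjective.range_comp, h.span_eq]⟩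

/-- If `j₀` is dropped from a basis of `N'` and replaced by its multiple by `a`, and the other
members are corrected by multiples of it, the result is a basis of the submodule `N` provided that
it lies in `N` and that only the multiples of `a` bring the `j₀`-th member into `N`. -/
theorem replace [IsDomain R] [Fintype J] [DecidableEq J] {N' : Submodule R M}
    (h : IsBasisOf v N') (hN : N ≤ N') (j₀ : J) {a : R} (ha : a ≠ 0) (c : J → R) (hc : c j₀ = 0)
    (hmem : ∀ j, j ≠ j₀ → v j - c j • v j₀ ∈ N) (hmem₀ : a • v j₀ ∈ N)
    (hdvd : ∀ r : R, r • v j₀ ∈ N → a ∣ r) :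
    IsBasisOf (fun j => (if j = j₀ then a else 1) • v j - c j • v j₀) N := by
  have hvj₀ : (if j₀ = j₀ then a else 1) • v j₀ - c j₀ • v j₀ = a • v j₀ := by simp [hc]
  have hmem' : ∀ j, (if j = j₀ then a else 1) • v j - c j • v j₀ ∈ N := by
    intro j
    by_cases hj : j = j₀
    · subst hj; rw [hvj₀]; exact hmem₀
    · simpa [hj] using hmem j hj
  have key : ∀ g : J → R, ∑ j, g j • ((if j = j₀ then a else 1) • v j - c j • v j₀) =
      ∑ j, (g j * (if j = j₀ then a else 1) - if j = j₀ then ∑ i, g i * c i else 0) • v j := by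
    intro g
    simp only [smul_sub, sub_smul, Finset.sum_sub_distrib, smul_smul]
    simp only [ite_smul, zero_smul, Finset.sum_ite_eq', Finset.mem_univ, if_true, Finset.sum_smul]
  constructor
  · rw [Fintype.linearIndependent_iff]
    intro g hg
    rw [key] at hg
    have h0 := Fintype.linearIndependent_iff.1 h.linearIndependent _ hg
    have h1 : ∀ j, j ≠ j₀ → g j = 0 := fun j hj => by simpa [hj] using h0 j
    intro j
    by_cases hj : j = j₀
    · have h2 := h0 j₀
      have h3 : ∑ i, g i * c i = 0 := by
        refine Finset.sum_eq_zero fun i _ => ?_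
        by_cases hi : i = j₀
        · rw [hi, hc, mul_zero]
        · rw [h1 i hi, zero_mul]
      simpa [h3, ha, hj] using h2
    · exact h1 j hj
  · apply le_antisymm
    · rw [Submodule.span_le]
      rintro _ ⟨j, rfl⟩
      exact hmem' j
    · intro θ hθ
      obtain ⟨f, rfl⟩ := h.exists_sum_eq (hN hθ)
      -- Removing the corrected members from θ leaves a multiple of `v j₀` that still lies in `N`,
      -- so its coefficient is divisible by `a`.
      have h1 : ∑ j, f j • v j - ∑ j ∈ Finset.univ.erase j₀, f j • (v j - c j • v j₀) =
          (f j₀ + ∑ j ∈ Finset.univ.erase j₀, f j * c j) • v j₀ := by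
        rw [← Finset.add_sum_erase _ _ (Finset.mem_univ j₀)]
        simp only [smul_sub, Finset.sum_sub_distrib, smul_smul, add_smul, Finset.sum_smul]
        abel
      have h2 : ∀ j ∈ Finset.univ.erase j₀, v j - c j • v j₀ ∈ N := fun j hj =>
        hmem j (Finset.ne_of_mem_erase hj)
      have h3 : (f j₀ + ∑ j ∈ Finset.univ.erase j₀, f j * c j) • v j₀ ∈ N := by
        rw [← h1]
        exact N.sub_mem hθ (N.sum_mem fun j hj => N.smul_mem _ (h2 j hj))
      obtain ⟨q, hq⟩ := hdvd _ h3
      rw [sub_eq_iff_eq_add] at h1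
      rw [h1, hq]
      refine Submodule.add_mem _ ?_ (Submodule.sum_mem _ fun j hj => Submodule.smul_mem _ _ ?_)
      · rw [mul_comm, mul_smul, ← hvj₀]
        exact Submodule.smul_mem _ _ (Submodule.subset_span ⟨j₀, rfl⟩)
      · refine Submodule.subset_span ⟨j, ?_⟩
        simp [Finset.ne_of_mem_erase hj]

end

end IsBasisOf

/-! ### Adding a hyperplane to a free multiarrangement. -/

namespace Multiarrangement

open PolyRing

variable {K : Type u} {V : Type v} [Field K] [AddCommGroup V] [Module K V]

theorem sum_derivation_apply {J : Type*} (s : Finset J) (b : J → PolyDer K V) (p : PolyRing K V) :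
    (∑ j ∈ s, b j) p = ∑ j ∈ s, b j p := by
  rw [← Derivation.coeFnAddMonoidHom_apply, map_sum, Finset.sum_apply]
  rfl

/-- Forms with the same kernel differ by a nonzero scalar, so the defining condition of
`derivations` need only be tested on one form per hyperplane. -/
theorem pow_dvd_iff_of_ker_eq {α β : Dual K V} (h : LinearMap.ker α = LinearMap.ker β)
    (hα : α ≠ 0) (θ : PolyDer K V) (m : ℕ) :
    linForm α ^ m ∣ θ (linForm α) ↔ linForm β ^ m ∣ θ (linForm β) := by
  obtain ⟨c, hc, rfl⟩ := eq_smul_of_ker_eq h hα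
  have hu : IsUnit (algebraMap K (PolyRing K V) c) := (IsUnit.mk0 c hc).map _
  rw [linForm_smul, mul_pow, (hu.pow m).mul_left_dvd, Derivation.leibniz, Derivation.map_algebraMap,
    smul_zero, add_zero, smul_eq_mul, hu.dvd_mul_left]

theorem deletion_mult_of_ne (A : Multiarrangement K V) {H₀ H : Submodule K V} (h : H ≠ H₀) :
    (A.deletion H₀).mult H = A.mult H := if_neg h

theorem deletion_mult_self (A : Multiarrangement K V) (H₀ : Submodule K V) :
    (A.deletion H₀).mult H₀ = A.mult H₀ - 1 := if_pos rfl

theorem deletion_mult_le (A : Multiarrangement K V) (H₀ H : Submodule K V) :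
    (A.deletion H₀).mult H ≤ A.mult H := by
  by_cases h : H = H₀
  · rw [h, deletion_mult_self]; exact Nat.sub_le _ _
  · rw [deletion_mult_of_ne A h]

theorem ne_zero_of_mult_ker_ne_zero {A : Multiarrangement K V} {α : Dual K V}
    (h : A.mult (LinearMap.ker α) ≠ 0) : α ≠ 0 := by
  rintro rfl
  exact (A.isCoatom _ h).1 LinearMap.ker_zero

theorem mem_derivations_iff_mem_deletion {A : Multiarrangement K V} {α : Dual K V}
    {θ : PolyDer K V} :
    θ ∈ A.derivations ↔ θ ∈ (A.deletion (LinearMap.ker α)).derivations ∧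
      linForm α ^ A.mult (LinearMap.ker α) ∣ θ (linForm α) := by
  constructor
  · intro h
    constructor
    · intro H hH β hβ
      have hle := deletion_mult_le A (LinearMap.ker α) H
      have hH' : A.mult H ≠ 0 := fun h0 => hH (Nat.le_zero.1 (h0 ▸ hle))
      exact (pow_dvd_pow _ hle).trans (h H hH' β hβ)
    · by_cases h0 : A.mult (LinearMap.ker α) = 0
      · rw [h0, pow_zero]; exact one_dvd _
      · exact h _ h0 α rfl
  · rintro ⟨h1, h2⟩ H hH β hβ
    by_cases hHα : H = LinearMap.ker α
    · subst hHα
      exact (pow_dvd_iff_of_ker_eq hβ.symm (ne_zero_of_mult_ker_ne_zero hH) θ _).1 h2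
    · have := h1 H (by
        change (A.deletion (LinearMap.ker α)).mult H ≠ 0
        rwa [deletion_mult_of_ne A hHα]) β hβ
      rwa [deletion_mult_of_ne A hHα] at this

theorem derivations_le_deletion (A : Multiarrangement K V) (α : Dual K V) :
    A.derivations ≤ (A.deletion (LinearMap.ker α)).derivations := fun _ h =>
  (mem_derivations_iff_mem_deletion.1 h).1

/-- Division by `α` leads from `D(𝒜, ν)` to the deletion. -/
theorem mem_deletion_of_smul_mem {A : Multiarrangement K V} {α : Dual K V} (hα : α ≠ 0)
    {η : PolyDer K V} (h : linForm α • η ∈ A.derivations) :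
    η ∈ (A.deletion (LinearMap.ker α)).derivations := by
  intro H hH β hβ
  have hH' : A.mult H ≠ 0 := fun h0 =>
    hH (Nat.le_zero.1 (h0 ▸ deletion_mult_le A (LinearMap.ker α) H))
  have h1 := h H hH' β hβ
  rw [Derivation.smul_apply, smul_eq_mul] at h1
  have hβ0 : β ≠ 0 := by
    subst hβ; exact ne_zero_of_mult_ker_ne_zero hH'
  by_cases hHα : H = LinearMap.ker α
  · subst hHα
    rw [deletion_mult_self]
    rw [← pow_dvd_iff_of_ker_eq hβ.symm hα]
    have h2 := h _ hH' α rfl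
    rw [Derivation.smul_apply, smul_eq_mul] at h2
    obtain ⟨k, hk⟩ := Nat.exists_eq_succ_of_ne_zero hH'
    rw [hk, Nat.succ_sub_one]
    rw [hk, pow_succ', mul_dvd_mul_iff_left (linForm_ne_zero hα)] at h2
    exact h2
  · rw [deletion_mult_of_ne A hHα]
    refine IsRelPrime.dvd_of_dvd_mul_left (IsRelPrime.pow_left ?_) h1
    refine isRelPrime_linForm hβ0 fun c hc => hHα ?_
    have hc0 : c ≠ 0 := by rintro rfl; exact hα (by rw [hc, zero_smul])
    rw [← hβ, hc, LinearMap.ker_smul _ _ hc0]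

theorem smul_mem_of_mem_deletion {A : Multiarrangement K V} {α : Dual K V}
    {η : PolyDer K V} (h : η ∈ (A.deletion (LinearMap.ker α)).derivations) :
    linForm α • η ∈ A.derivations := by
  rw [mem_derivations_iff_mem_deletion (α := α)]
  refine ⟨Submodule.smul_mem _ _ h, ?_⟩
  rw [Derivation.smul_apply, smul_eq_mul]
  by_cases h0 : A.mult (LinearMap.ker α) - 1 = 0
  · exact (pow_dvd_pow _ (show _ ≤ 1 by omega)).trans (by rw [pow_one]; exact dvd_mul_right _ _)
  · have := h (LinearMap.ker α) (by
      change (A.deletion (LinearMap.ker α)).mult _ ≠ 0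
      rwa [deletion_mult_self]) α rfl
    rw [deletion_mult_self] at this
    rw [show A.mult (LinearMap.ker α) = A.mult (LinearMap.ker α) - 1 + 1 by omega, pow_succ']
    exact mul_dvd_mul_left _ this

/-- Taking the part of degree `D` of both sides makes the coefficient of `B` homogeneous of the
expected degree, or zero where that degree would be negative. -/
theorem exists_homogeneous_coeff {a B c s p : PolyRing K V} {D μ e : ℕ}
    (ha : a ∈ homogeneousPart K V 1) (hB : B ∈ homogeneousPart K V e)
    (hp : p ∈ homogeneousPart K V D) (h : p = a ^ μ * (c * B + a * s)) :
    ∃ c' s' : PolyRing K V, p = a ^ μ * (c' * B + a * s') ∧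
      (c' = 0 ∨ μ + e ≤ D ∧ c' ∈ homogeneousPart K V (D - (μ + e))) := by
  have haμ : a ^ μ ∈ homogeneousPart K V μ := by simpa using pow_mem_homogeneousPart ha μ
  have haμ1 : a ^ (μ + 1) ∈ homogeneousPart K V (μ + 1) := by
    simpa using pow_mem_homogeneousPart ha (μ + 1)
  have h1 : ∃ c', component D (a ^ μ * B * c) = a ^ μ * B * c' ∧
      (c' = 0 ∨ μ + e ≤ D ∧ c' ∈ homogeneousPart K V (D - (μ + e))) := by
    by_cases hD : μ + e ≤ D
    · refine ⟨component (D - (μ + e)) c, ?_, Or.inr ⟨hD, component_mem _ _⟩⟩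
      rw [← component_mul_of_mem (mul_mem_homogeneousPart haμ hB), Nat.add_sub_cancel' hD]
    · refine ⟨0, ?_, Or.inl rfl⟩
      rw [component_mul_of_mem_of_lt (mul_mem_homogeneousPart haμ hB) _ (not_le.1 hD), mul_zero]
  have h2 : ∃ s', component D (a ^ (μ + 1) * s) = a ^ (μ + 1) * s' := by
    by_cases hD : μ + 1 ≤ D
    · refine ⟨component (D - (μ + 1)) s, ?_⟩
      rw [← component_mul_of_mem haμ1, Nat.add_sub_cancel' hD]
    · refine ⟨0, ?_⟩
      rw [component_mul_of_mem_of_lt haμ1 _ (not_le.1 hD), mul_zero]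
  obtain ⟨c', hc', hc''⟩ := h1
  obtain ⟨s', hs'⟩ := h2
  refine ⟨c', s', ?_, hc''⟩
  rw [← component_of_mem hp, h,
    show a ^ μ * (c * B + a * s) = a ^ μ * B * c + a ^ (μ + 1) * s by ring, map_add, hc', hs']
  ring

/-- Addition of a hyperplane `ker α` to a free multiarrangement: if `θ(α) / α ^ μ`, taken modulo
`α`, runs through the multiples of one form `B` as `θ` runs through the derivations of the
deletion, then some member of a homogeneous basis of the deletion is to be multiplied by `α`. -/
theorem exists_basis_of_deletion {A : Multiarrangement K V} {α : Dual K V} {μ : ℕ}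
    (hμ : A.mult (LinearMap.ker α) = μ + 1) {J : Type*} [Fintype J] [DecidableEq J]
    {b : J → PolyDer K V} {d : J → ℕ}
    (hb : IsBasisOf b (A.deletion (LinearMap.ker α)).derivations)
    (hd : ∀ j, HasPdeg (b j) (d j)) {B : PolyRing K V} {e : ℕ}
    (hB : B ∈ homogeneousPart K V e) (hB0 : ¬ linForm α ∣ B)
    (hdiv : ∀ θ ∈ (A.deletion (LinearMap.ker α)).derivations,
      ∃ c s, θ (linForm α) = linForm α ^ μ * (c * B + linForm α * s))
    (hφ : ∃ φ ∈ (A.deletion (LinearMap.ker α)).derivations, ∃ κ : K, κ ≠ 0 ∧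
      ∃ s, φ (linForm α) = linForm α ^ μ * (algebraMap K _ κ * B + linForm α * s)) :
    ∃ j₀, d j₀ = μ + e ∧ b j₀ (linForm α) ≠ 0 ∧ ∃ c : J → PolyRing K V, c j₀ = 0 ∧
      (∀ j, b j (linForm α) = 0 → c j = 0) ∧
      (∀ j, HasPdeg (b j - c j • b j₀) (d j)) ∧
      IsBasisOf (fun j => (if j = j₀ then linForm α else 1) • b j - c j • b j₀)
        A.derivations := by
  have hα : α ≠ 0 := ne_zero_of_mult_ker_ne_zero (by rw [hμ]; exact Nat.succ_ne_zero μ)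
  have hL := linForm_ne_zero hα
  have hP := prime_linForm hα
  have hLμ : linForm α ^ μ ≠ 0 := pow_ne_zero _ hL
  have hc : ∀ j, ∃ c s, b j (linForm α) = linForm α ^ μ * (c * B + linForm α * s) ∧
      (c = 0 ∨ μ + e ≤ d j ∧ c ∈ homogeneousPart K V (d j - (μ + e))) ∧
      (b j (linForm α) = 0 → c = 0) := by
    intro j
    -- The coefficient is chosen to be 0 for members that kill α, so that the constant derivations
    -- along the center stay unchanged.
    by_cases h0 : b j (linForm α) = 0
    · exact ⟨0, 0, by simp [h0], Or.inl rfl, fun _ => rfl⟩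
    · obtain ⟨c, s, h⟩ := hdiv _ (hb.mem j)
      obtain ⟨c', s', h', hc'⟩ :=
        exists_homogeneous_coeff (linForm_mem_homogeneousPart α) hB (hd j α) h
      exact ⟨c', s', h', hc', fun h => absurd h h0⟩
  choose c s hcs hchom hc0 using hc
  obtain ⟨φ, hφD, κ, hκ, t, hφt⟩ := hφ
  obtain ⟨f, rfl⟩ := hb.exists_sum_eq hφD
  have h1 : linForm α ∣ (∑ j, f j * c j - algebraMap K _ κ) * B := by
    have h2 : ∑ j, f j * (c j * B + linForm α * s j) =
        algebraMap K _ κ * B + linForm α * t := by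
      apply mul_left_cancel₀ hLμ
      rw [← hφt, sum_derivation_apply, Finset.mul_sum]
      refine Finset.sum_congr rfl fun j _ => ?_
      rw [Derivation.smul_apply, smul_eq_mul, hcs j]
      ring
    refine ⟨t - ∑ j, f j * s j, ?_⟩
    have h3 : ∑ j, f j * (c j * B + linForm α * s j) =
        (∑ j, f j * c j) * B + linForm α * ∑ j, f j * s j := by
      rw [Finset.sum_mul, Finset.mul_sum, ← Finset.sum_add_distrib]
      exact Finset.sum_congr rfl fun j _ => by ring
    rw [h3] at h2
    linear_combination h2
  obtain ⟨q, hq⟩ := (hP.dvd_or_dvd h1).resolve_right hB0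
  -- At the origin α vanishes, so the constant terms of the products f_j c_j add up to κ. Hence some
  -- c_j has a nonzero constant term and, being homogeneous, is a nonzero constant.
  have h2 : ∑ j, constantCoeff (f j) * constantCoeff (c j) = κ := by
    have := congrArg constantCoeff hq
    simpa [constantCoeff_linForm, sub_eq_zero] using this
  obtain ⟨j₀, -, hj₀⟩ := Finset.exists_ne_zero_of_sum_ne_zero (h2.trans_ne hκ)
  have hcj₀ : constantCoeff (c j₀) ≠ 0 := right_ne_zero_of_mul hj₀
  have hcj₀' : c j₀ ≠ 0 := fun h => hcj₀ (by rw [h, map_zero])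
  obtain ⟨hle, hmem⟩ := (hchom j₀).resolve_left hcj₀'
  have hdj₀ : d j₀ = μ + e := by
    by_contra hne
    exact hcj₀ (constantCoeff_eq_zero hmem (by omega))
  have hunit : c j₀ = algebraMap K _ (constantCoeff (c j₀)) := by
    apply eq_algebraMap_of_mem
    rwa [hdj₀, Nat.sub_self] at hmem
  set k := constantCoeff (c j₀) with hk
  have hkk : algebraMap K (PolyRing K V) k * algebraMap K (PolyRing K V) k⁻¹ = 1 := by
    rw [← map_mul, mul_inv_cancel₀ hcj₀, map_one]
  refine ⟨j₀, hdj₀, fun h => hcj₀' (hc0 j₀ h),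
    fun j => if j = j₀ then 0 else c j * algebraMap K _ k⁻¹, if_pos rfl, ?_, ?_, ?_⟩
  · intro j hj
    simp [hc0 j hj]
  · intro j β
    rw [Derivation.sub_apply, Derivation.smul_apply, smul_eq_mul]
    refine Submodule.sub_mem _ (hd j β) ?_
    beta_reduce
    split_ifs
    · rw [zero_mul]; exact Submodule.zero_mem _
    · rcases hchom j with h0 | ⟨h1, h2⟩
      · rw [h0]; simp
      · have := mul_mem_homogeneousPart
          (mul_mem_homogeneousPart h2 (algebraMap_mem_homogeneousPart k⁻¹)) (hd j₀ β)
        rwa [hdj₀, add_zero, Nat.sub_add_cancel h1] at this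
  · apply hb.replace (derivations_le_deletion A α) j₀ hL _ (if_pos rfl)
    · intro j hj
      rw [mem_derivations_iff_mem_deletion (α := α)]
      refine ⟨Submodule.sub_mem _ (hb.mem j) (Submodule.smul_mem _ _ (hb.mem j₀)), ?_⟩
      rw [if_neg hj, hμ, Derivation.sub_apply, Derivation.smul_apply, smul_eq_mul, hcs j, hcs j₀,
        hunit]
      refine ⟨s j - c j * algebraMap K _ k⁻¹ * s j₀, ?_⟩
      linear_combination (- linForm α ^ μ * c j * B) * hkk
    · exact smul_mem_of_mem_deletion (hb.mem j₀)
    -- If r times the chosen member lies in the smaller module, α divides r c B with c a unit; α is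
    -- prime and does not divide B, so it divides r.
    · intro r hr
      have hr := (mem_derivations_iff_mem_deletion (α := α)).1 hr |>.2
      rw [hμ, Derivation.smul_apply, smul_eq_mul, hcs j₀, pow_succ, mul_left_comm,
        mul_dvd_mul_iff_left hLμ, mul_add, mul_left_comm r (linForm α),
        dvd_add_left (dvd_mul_right _ _), ← mul_assoc] at hr
      have hr := (hP.dvd_or_dvd hr).resolve_right hB0
      rw [hunit] at hr
      have := hr.mul_right (algebraMap K _ k⁻¹)
      rwa [mul_assoc, hkk, mul_one] at this

end Multiarrangement

/-! ### Divisibility on a triangle of hyperplanes. -/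

section LocalDivisibility

theorem exists_eq_of_cast_mul_eq (K : Type*) {R : Type*} [Field K] [CharZero K] [CommRing R]
    [Algebra K R] (k : ℕ) (hk : k ≠ 0) {f w p q z t : R}
    (h : (k : R) * f + w * t = z * p + w * q) : ∃ p' q', f = z * p' + w * q' := by
  have hk' : algebraMap K R (k : K)⁻¹ * (k : R) = 1 := by
    rw [← map_natCast (algebraMap K R), ← map_mul, inv_mul_cancel₀ (Nat.cast_ne_zero.2 hk), map_one]
  refine ⟨algebraMap K R (k : K)⁻¹ * p, algebraMap K R (k : K)⁻¹ * (q - t), ?_⟩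
  linear_combination (algebraMap K R (k : K)⁻¹) * h - f * hk'

variable {K R : Type*} [Field K] [CharZero K] [CommRing R] [Algebra K R]

/-- Differentiation in the direction of z lowers b by one and turns f into a nonzero integer
multiple of f plus a multiple of y - z. For b = 0 the claim is the congruence of y^c and z^c modulo
y - z. -/
theorem exists_eq_of_pow_mul_sub_pow_mul_zero {y z : R} (D₂ : Derivation K R R) (hy₂ : D₂ y = 0)
    (hz₂ : D₂ z = 1) (b c : ℕ) {g h f : R}
    (H : y ^ c * g - z ^ (b + c) * h = (y - z) ^ b * f) :
    ∃ p q, f = z ^ c * p + (y - z) * q := by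
  induction b generalizing g h f with
  | zero =>
    obtain ⟨w, hw⟩ := sub_dvd_pow_sub_pow y z c
    refine ⟨g - h, w * g, ?_⟩
    rw [zero_add, pow_zero, one_mul] at H
    linear_combination -H + g * hw
  | succ b ih =>
    have H' := congrArg D₂ H
    rw [show b + 1 + c = (b + c) + 1 by ring] at H'
    simp only [map_sub, Derivation.leibniz, Derivation.leibniz_pow, hy₂, hz₂, smul_eq_mul,
      nsmul_eq_mul, Nat.add_sub_cancel, mul_zero, smul_zero, mul_one] at H'
    obtain ⟨p, q, hpq⟩ := ih (g := D₂ g) (h := ((b + c + 1 : ℕ) : R) * h + z * D₂ h)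
      (f := -(((b + 1 : ℕ) : R) * f) + (y - z) * D₂ f) (by
        push_cast at H' ⊢
        linear_combination H')
    exact exists_eq_of_cast_mul_eq K (b + 1) (Nat.succ_ne_zero b) (f := f) (w := y - z)
      (p := -p) (q := -q) (z := z ^ c) (t := - D₂ f) (by linear_combination -hpq)

/-- For the multiplicities `a + c`, `b + c`, `a + b` on the lines `y = 0`, `z = 0`, `y = z`, the
quotient of a difference by `(y - z) ^ (a + b)` is divisible by `z ^ c` modulo `y - z`. -/
theorem exists_eq_of_pow_mul_sub_pow_mul {y z : R} (D₁ D₂ : Derivation K R R) (hy₁ : D₁ y = 1)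
    (hz₁ : D₁ z = 0) (hy₂ : D₂ y = 0) (hz₂ : D₂ z = 1) (a b c : ℕ) {g h f : R}
    (H : y ^ (a + c) * g - z ^ (b + c) * h = (y - z) ^ (a + b) * f) :
    ∃ p q, f = z ^ c * p + (y - z) * q := by
  induction a generalizing g h f with
  | zero =>
    rw [zero_add, zero_add] at H
    exact exists_eq_of_pow_mul_sub_pow_mul_zero D₂ hy₂ hz₂ b c H
  | succ a ih =>
    -- Differentiation in the direction of y lowers a by one and replaces f by (a + b + 1) f modulo
    -- y - z; the integer is invertible in characteristic 0.
    have H' := congrArg D₁ H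
    rw [show a + 1 + c = (a + c) + 1 by ring, show a + 1 + b = (a + b) + 1 by ring] at H'
    simp only [map_sub, Derivation.leibniz, Derivation.leibniz_pow, hy₁, hz₁, smul_eq_mul,
      nsmul_eq_mul, Nat.add_sub_cancel, mul_zero, smul_zero, mul_one] at H'
    obtain ⟨p, q, hpq⟩ := ih (g := ((a + c + 1 : ℕ) : R) * g + y * D₁ g) (h := D₁ h)
      (f := ((a + b + 1 : ℕ) : R) * f + (y - z) * D₁ f) (by
        push_cast at H' ⊢
        linear_combination H')
    exact exists_eq_of_cast_mul_eq K (a + b + 1) (Nat.succ_ne_zero _) hpq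

end LocalDivisibility

/-! ### Formal integration and the Beta integral. -/

section Antiderivative

open Polynomial

variable (K : Type*) {R : Type*} [Field K] [CommRing R] [Algebra K R]

/-- The integral of a polynomial from `0` to `1`. -/
noncomputable def unitIntegral : R[X] →ₗ[R] R :=
  Polynomial.lsum fun n => LinearMap.mulLeft R (algebraMap K R ((n + 1 : ℕ) : K)⁻¹)

theorem unitIntegral_monomial (n : ℕ) (a : R) :
    unitIntegral K (monomial n a) = algebraMap K R ((n + 1 : ℕ) : K)⁻¹ * a := by
  simp [unitIntegral, Polynomial.lsum_apply]

variable [CharZero K]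

theorem algebraMap_inv_mul_cast (n : ℕ) :
    algebraMap K R ((n + 1 : ℕ) : K)⁻¹ * ((n + 1 : ℕ) : R) = 1 := by
  rw [← map_natCast (algebraMap K R), ← map_mul,
    inv_mul_cancel₀ (Nat.cast_ne_zero.2 (Nat.succ_ne_zero n)), map_one]

theorem unitIntegral_derivative (P : R[X]) :
    unitIntegral K (derivative P) = P.eval 1 - P.eval 0 := by
  induction P using Polynomial.induction_on' with
  | add p q hp hq => rw [derivative_add, map_add, hp, hq, eval_add, eval_add]; ring
  | monomial n a =>
    cases n with
    | zero => simp
    | succ n =>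
      rw [derivative_monomial, Nat.add_sub_cancel, unitIntegral_monomial, mul_comm a, ← mul_assoc,
        algebraMap_inv_mul_cast]
      simp

/-- Integration by parts moves a factor from X - 1 to X: the boundary terms vanish, and each step
contributes a nonzero rational factor. -/
theorem unitIntegral_beta (q p : ℕ) : ∃ κ : K, κ ≠ 0 ∧
    unitIntegral K ((X : R[X]) ^ q * (X - 1) ^ p) = algebraMap K R κ := by
  induction p generalizing q with
  | zero =>
    refine ⟨((q + 1 : ℕ) : K)⁻¹, inv_ne_zero (Nat.cast_ne_zero.2 (Nat.succ_ne_zero q)), ?_⟩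
    rw [pow_zero, mul_one, ← monomial_one_right_eq_X_pow, unitIntegral_monomial, mul_one]
  | succ p ih =>
    obtain ⟨κ, hκ, h⟩ := ih (q + 1)
    refine ⟨-(((q + 1 : ℕ) : K)⁻¹ * (((p + 1 : ℕ) : K) * κ)), ?_, ?_⟩
    · exact neg_ne_zero.2 (mul_ne_zero (inv_ne_zero (Nat.cast_ne_zero.2 (Nat.succ_ne_zero q)))
        (mul_ne_zero (Nat.cast_ne_zero.2 (Nat.succ_ne_zero p)) hκ))
    · have h1 := unitIntegral_derivative K ((X : R[X]) ^ (q + 1) * (X - 1) ^ (p + 1))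
      have h2 : derivative ((X : R[X]) ^ (q + 1) * (X - 1) ^ (p + 1)) =
          ((q + 1 : ℕ) : R) • (X ^ q * (X - 1) ^ (p + 1)) +
            ((p + 1 : ℕ) : R) • (X ^ (q + 1) * (X - 1) ^ p) := by
        simp only [derivative_mul, derivative_pow, derivative_X, derivative_sub, derivative_one,
          smul_eq_C_mul, Nat.add_sub_cancel]
        ring
      rw [h2, map_add, map_smul, map_smul, h] at h1
      simp only [smul_eq_mul, eval_mul, eval_pow, eval_X, eval_sub, eval_one, sub_self,
        ne_eq, Nat.succ_ne_zero, not_false_eq_true, zero_pow, mul_zero, zero_mul] at h1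
      have h3 := algebraMap_inv_mul_cast K (R := R) q
      rw [map_neg, map_mul (algebraMap K R), map_mul (algebraMap K R), map_natCast]
      linear_combination (algebraMap K R ((q + 1 : ℕ) : K)⁻¹) * h1 -
        unitIntegral K ((X : R[X]) ^ q * (X - 1) ^ (p + 1)) * h3

theorem exists_derivative_eq (K : Type*) {R : Type*} [Field K] [CharZero K] [CommRing R]
    [Algebra K R] (F : R[X]) : ∃ P : R[X], derivative P = F := by
  induction F using Polynomial.induction_on' with
  | add p q hp hq =>
    obtain ⟨P, rfl⟩ := hp
    obtain ⟨Q, rfl⟩ := hq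
    exact ⟨P + Q, derivative_add⟩
  | monomial n a =>
    refine ⟨monomial (n + 1) (a * algebraMap K R ((n + 1 : ℕ) : K)⁻¹), ?_⟩
    rw [derivative_monomial, mul_assoc, algebraMap_inv_mul_cast, mul_one, Nat.add_sub_cancel]

/-- The leading term of the integral of `(t - a) ^ q (t - b) ^ p G(t)` from `a` to `b`, as `b`
tends to `a`. -/
theorem exists_eval_sub_eval_eq (q p : ℕ) : ∃ κ : K, κ ≠ 0 ∧ ∀ (a b : R) (P G : R[X]),
    derivative P = (X - C a) ^ q * (X - C b) ^ p * G →
    ∃ s, P.eval b - P.eval a =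
      (b - a) ^ (q + p + 1) * (algebraMap K R κ * G.eval a + (b - a) * s) := by
  obtain ⟨κ, hκ, hI⟩ := unitIntegral_beta K (R := R) q p
  refine ⟨κ, hκ, fun a b P G hP => ?_⟩
  set w := b - a with hw
  -- After the substitution t = a + wX the integral runs from 0 to 1, and G(t) is replaced by G(a)
  -- up to a multiple of w.
  have h1 : C w * X ∣ G.comp (C a + C w * X) - C (G.eval a) := by
    have := sub_dvd_eval_sub (C a + C w * X) (C a) (G.map C)
    rwa [add_sub_cancel_left, eval_map, ← comp, eval_map, ← comp, comp_C] at this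
  obtain ⟨Q, hQ⟩ := h1
  have h2 := unitIntegral_derivative K (P.comp (C a + C w * X))
  have h3 : derivative (P.comp (C a + C w * X)) =
      w ^ (q + p + 1) • (G.eval a • (X ^ q * (X - 1) ^ p) +
        w • (X ^ q * (X - 1) ^ p * X * Q)) := by
    have e1 : (X - C a).comp (C a + C w * X) = C w * X := by simp
    have e2 : (X - C b).comp (C a + C w * X) = C w * (X - 1) := by
      simp only [sub_comp, X_comp, C_comp, hw, C_sub]; ring
    rw [derivative_comp, hP, mul_comp, mul_comp, pow_comp, pow_comp, e1, e2, mul_pow _ (X - 1),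
      sub_eq_iff_eq_add.1 hQ]
    simp only [derivative_add, derivative_C, derivative_mul, derivative_X, smul_eq_C_mul, C_pow]
    ring
  rw [h3, map_smul, map_add, map_smul, map_smul, hI] at h2
  refine ⟨unitIntegral K (X ^ q * (X - 1) ^ p * X * Q), ?_⟩
  simp only [eval_comp, eval_add, eval_C, eval_mul, eval_X, mul_one, mul_zero, add_zero,
    smul_eq_mul] at h2
  rw [show a + w = b by rw [hw]; ring] at h2
  rw [← h2]
  ring

end Antiderivative

open PolyRing

/-! ### Affinely independent families of linear forms. -/

section Frame

variable {K : Type u} {V : Type v} [Field K] [AddCommGroup V] [Module K V]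
variable {ι : Type*}

/-- The differences of the linear forms `x i`, for `i ∈ U`, take arbitrary values: the family of
the `x i` is affinely independent. -/
def IsFrame (U : Finset ι) (x : ι → Dual K V) : Prop :=
  ∀ g : ι → K, ∃ w : V, ∀ i ∈ U, ∀ j ∈ U, (x i - x j) w = g i - g j

namespace IsFrame

variable {U : Finset ι} {x : ι → Dual K V}

theorem mono (hx : IsFrame U x) {U' : Finset ι} (h : U' ⊆ U) : IsFrame U' x := fun g =>
  (hx g).imp fun _ hw i hi j hj => hw i (h hi) j (h hj)

variable [DecidableEq ι]

theorem sub_ne_zero (hx : IsFrame U x) {i j : ι} (hi : i ∈ U) (hj : j ∈ U) (hij : i ≠ j) :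
    x i - x j ≠ 0 := by
  obtain ⟨w, hw⟩ := hx (Pi.single i 1)
  intro h
  have := hw i hi j hj
  simp [h, hij.symm] at this

/-- Since the differences take arbitrary values, proportionality can be tested on indicator
functions of single vertices. -/
theorem eq_or_eq_of_eq_smul (hx : IsFrame U x) {i j a b : ι} (hi : i ∈ U) (hj : j ∈ U)
    (ha : a ∈ U) (hb : b ∈ U) (hab : a ≠ b) {c : K} (h : x a - x b = c • (x i - x j)) :
    a = i ∧ b = j ∨ a = j ∧ b = i := by
  have key : ∀ g : ι → K, g a - g b = c * (g i - g j) := by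
    intro g
    obtain ⟨w, hw⟩ := hx g
    rw [← hw a ha b hb, ← hw i hi j hj, h]
    rfl
  have h1 : a = i ∨ a = j := by
    by_contra! h
    simpa [hab.symm, h.1.symm, h.2.symm] using key (Pi.single a 1)
  have h2 : b = i ∨ b = j := by
    by_contra! h
    simpa [hab, h.1.symm, h.2.symm] using key (Pi.single b 1)
  rcases h1 with rfl | rfl <;> rcases h2 with rfl | rfl <;> simp_all

theorem eq_or_eq_of_ker_eq (hx : IsFrame U x) {i j a b : ι} (hi : i ∈ U) (hj : j ∈ U)
    (ha : a ∈ U) (hb : b ∈ U) (hij : i ≠ j) (hab : a ≠ b)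
    (h : LinearMap.ker (x a - x b) = LinearMap.ker (x i - x j)) :
    a = i ∧ b = j ∨ a = j ∧ b = i := by
  obtain ⟨c, -, hc⟩ := eq_smul_of_ker_eq h.symm (hx.sub_ne_zero hi hj hij)
  exact hx.eq_or_eq_of_eq_smul hi hj ha hb hab hc

/-- The derivation is ∑ g_i ∂_i, where ∂_i is the constant derivation in a direction that moves x_i
by 1 relative to the others. -/
theorem exists_derivation (hx : IsFrame U x) (g : ι → PolyRing K V) :
    ∃ θ : PolyDer K V, ∀ i ∈ U, ∀ j ∈ U, θ (linForm (x i - x j)) = g i - g j := by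
  choose w hw using fun i : ι => hx (Pi.single i 1)
  have key : ∀ a ∈ U,
      ∑ i ∈ U, g i * algebraMap K (PolyRing K V) ((Pi.single i 1 : ι → K) a) = g a := by
    intro a ha
    rw [Finset.sum_eq_single_of_mem a ha]
    · simp
    · intro i _ hi
      simp [hi.symm]
  refine ⟨∑ i ∈ U, g i • directional (w i), fun a ha b hb => ?_⟩
  rw [Multiarrangement.sum_derivation_apply]
  simp only [Derivation.smul_apply, directional_linForm, smul_eq_mul, hw _ a ha b hb]
  simp only [map_sub, mul_sub, Finset.sum_sub_distrib]
  rw [key a ha, key b hb]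

end IsFrame

end Frame

/-! ### Leading terms along the hyperplane of an edge. -/

namespace Multiarrangement

variable {K : Type u} {V : Type v} [Field K] [AddCommGroup V] [Module K V]
variable {ι : Type*} {A : Multiarrangement K V} {U : Finset ι} {x : ι → Dual K V}
  {m : ι → ι → ℕ}

/-- `A` consists of the hyperplanes `x i = x j` with multiplicities `m i j`, for `i ≠ j` in `U`. -/
structure IsWeighted (A : Multiarrangement K V) (U : Finset ι) (x : ι → Dual K V)
    (m : ι → ι → ℕ) : Prop where
  mult_ker : ∀ i ∈ U, ∀ j ∈ U, i ≠ j → A.mult (LinearMap.ker (x i - x j)) = m i j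
  exists_of_mult_ne_zero : ∀ H, A.mult H ≠ 0 →
    ∃ i ∈ U, ∃ j ∈ U, i ≠ j ∧ H = LinearMap.ker (x i - x j)

theorem IsWeighted.congr (hA : A.IsWeighted U x m) {m' : ι → ι → ℕ}
    (h : ∀ i ∈ U, ∀ j ∈ U, i ≠ j → m i j = m' i j) : A.IsWeighted U x m' :=
  ⟨fun i hi j hj hij => (hA.mult_ker i hi j hj hij).trans (h i hi j hj hij),
    hA.exists_of_mult_ne_zero⟩

theorem IsWeighted.mem_derivations [DecidableEq ι] (hA : A.IsWeighted U x m) (hx : IsFrame U x)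
    {θ : PolyDer K V} :
    θ ∈ A.derivations ↔ ∀ i ∈ U, ∀ j ∈ U, i ≠ j →
      linForm (x i - x j) ^ m i j ∣ θ (linForm (x i - x j)) := by
  constructor
  · intro h i hi j hj hij
    have hm := hA.mult_ker i hi j hj hij
    by_cases h0 : m i j = 0
    · rw [h0, pow_zero]; exact one_dvd _
    · rw [← hm]
      exact h _ (show A.mult _ ≠ 0 by rwa [hm]) _ rfl
  · intro h H hH α hα
    obtain ⟨i, hi, j, hj, hij, rfl⟩ := hA.exists_of_mult_ne_zero H hH
    rw [hA.mult_ker i hi j hj hij, ← pow_dvd_iff_of_ker_eq hα.symm (hx.sub_ne_zero hi hj hij)]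
    exact h i hi j hj hij

variable [DecidableEq ι]

/-- The product of the `(x k - x s) ^ c s` for `s ∈ U` other than `v` and `k`. -/
noncomputable def restrictionForm (U : Finset ι) (x : ι → Dual K V) (v k : ι) (c : ι → ℕ) :
    PolyRing K V :=
  ∏ s ∈ (U.erase v).erase k, linForm (x k - x s) ^ c s

theorem restrictionForm_mem (U : Finset ι) (x : ι → Dual K V) (v k : ι) (c : ι → ℕ) :
    restrictionForm U x v k c ∈ homogeneousPart K V (∑ s ∈ (U.erase v).erase k, c s) :=
  prod_mem_homogeneousPart _ _ _ fun s _ => by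
    simpa using pow_mem_homogeneousPart (linForm_mem_homogeneousPart (x k - x s)) (c s)

theorem not_dvd_restrictionForm (hx : IsFrame U x) {v k : ι} (hv : v ∈ U) (hk : k ∈ U)
    (hvk : v ≠ k) (c : ι → ℕ) : ¬ linForm (x v - x k) ∣ restrictionForm U x v k c := by
  intro h
  have h0 := hx.sub_ne_zero hv hk hvk
  obtain ⟨s, hs, h1⟩ := (prime_linForm h0).exists_mem_finset_dvd h
  have h2 := (prime_linForm h0).dvd_of_dvd_pow h1
  obtain ⟨c, hc⟩ := linForm_dvd_linForm h0 h2
  simp only [Finset.mem_erase] at hs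
  rcases hx.eq_or_eq_of_eq_smul hv hk hk hs.2.2 (Ne.symm hs.1) hc with h | h
  · exact hvk h.1.symm
  · exact hs.2.1 h.2

/-- Modulo x_v - x_k, the quotient f is divisible by each power (x_k - x_s)^(c s), by the lemma on
triangles. The forms x_k - x_s for different s are coprime, so the product divides as well. -/
theorem exists_eq_mul_restrictionForm [CharZero K] (hA : A.IsWeighted U x m) (hx : IsFrame U x)
    {v k : ι} (hv : v ∈ U) (hk : k ∈ U) (hvk : v ≠ k) {a b : ℕ} (c : ι → ℕ)
    (hm : m v k = a + b)
    (hmv : ∀ s ∈ U, s ≠ v → s ≠ k → a + c s ≤ m v s)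
    (hmk : ∀ s ∈ U, s ≠ v → s ≠ k → b + c s ≤ m k s)
    {θ : PolyDer K V} (hθ : θ ∈ A.derivations) :
    ∃ p q, θ (linForm (x v - x k)) =
      linForm (x v - x k) ^ (a + b) * (p * restrictionForm U x v k c + linForm (x v - x k) * q) := by
  rw [hA.mem_derivations hx] at hθ
  obtain ⟨f, hf⟩ := hθ v hv k hk hvk
  rw [hm] at hf
  obtain ⟨w, hw⟩ := hx (Pi.single v 1)
  obtain ⟨w', hw'⟩ := hx (Pi.single k 1)
  have hαw : (x v - x k) w = 1 := by rw [hw v hv k hk]; simp [hvk.symm]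
  set σ := projectHom (x v - x k) w with hσ
  -- The projection σ puts x_k for x_v, up to a common shift, and fixes the x_k - x_s. Divisibility
  -- modulo x_v - x_k thus becomes divisibility of σ f.
  have hdvd : restrictionForm U x v k c ∣ σ f := by
    apply Finset.prod_dvd_of_isRelPrime
    · intro s hs t ht hst
      simp only [Finset.coe_erase, Set.mem_sdiff, Finset.mem_coe, Set.mem_singleton_iff] at hs ht
      refine IsRelPrime.pow (isRelPrime_linForm (hx.sub_ne_zero hk hs.1.1 (Ne.symm hs.2)) ?_)
      intro d hd
      rcases hx.eq_or_eq_of_eq_smul hk hs.1.1 hk ht.1.1 (Ne.symm ht.2) hd with h | h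
      · exact hst h.2.symm
      · exact hs.2 h.1.symm
    · intro s hs
      simp only [Finset.mem_erase] at hs
      obtain ⟨hsk, hsv, hsU⟩ := hs
      have hy₁ : directional w (linForm (x v - x s)) = 1 := by
        rw [directional_linForm, hw v hv s hsU]; simp [hsv]
      have hz₁ : directional w (linForm (x k - x s)) = 0 := by
        rw [directional_linForm, hw k hk s hsU]; simp [hsv, hvk.symm]
      have hy₂ : directional w' (linForm (x v - x s)) = 0 := by
        rw [directional_linForm, hw' v hv s hsU]; simp [hsk, hvk]
      have hz₂ : directional w' (linForm (x k - x s)) = 1 := by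
        rw [directional_linForm, hw' k hk s hsU]; simp [hsk]
      have hyz : linForm (x v - x s) - linForm (x k - x s) = linForm (x v - x k) := by
        rw [← linForm_sub, sub_sub_sub_cancel_right]
      obtain ⟨g, hg⟩ := (pow_dvd_pow _ (hmv s hsU hsv hsk)).trans (hθ v hv s hsU hsv.symm)
      obtain ⟨h, hh⟩ := (pow_dvd_pow _ (hmk s hsU hsv hsk)).trans (hθ k hk s hsU hsk.symm)
      obtain ⟨p, q, hpq⟩ := exists_eq_of_pow_mul_sub_pow_mul (directional w) (directional w')
        hy₁ hz₁ hy₂ hz₂ a b (c s) (g := g) (h := h) (f := f) (by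
          rw [← hg, ← hh, ← map_sub θ, hyz, hf])
      have hσz : σ (linForm (x k - x s)) = linForm (x k - x s) := by
        rw [hσ, projectHom_linForm, hw k hk s hsU]; simp [hsv, hvk.symm]
      have hσα : σ (linForm (x v - x k)) = 0 := (linForm_dvd_iff hαw).1 dvd_rfl
      rw [hpq, hyz, map_add, map_mul, map_mul, map_pow, hσz, hσα, zero_mul, add_zero]
      exact dvd_mul_right _ _
  obtain ⟨p, hp⟩ := hdvd
  obtain ⟨q, hq⟩ := dvd_projectHom_sub (x v - x k) w f
  refine ⟨p, -q, ?_⟩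
  rw [hf]
  congr 1
  rw [← hσ, hp] at hq
  linear_combination -hq

/-- When v has weight 0, a derivation that moves x_v alone, by the product of the required powers of
the x_v - x_s, already has the smallest possible leading term: modulo x_v - x_k that product becomes
the one with x_k - x_s. -/
theorem exists_leading_derivation_of_eq_zero (hA : A.IsWeighted U x m) (hx : IsFrame U x)
    {v k : ι} (hv : v ∈ U) (hk : k ∈ U) (hvk : v ≠ k) {b : ℕ} (c : ι → ℕ)
    (hm : m v k = b) (hm' : m k v = b)
    (hmv : ∀ s ∈ U, s ≠ v → s ≠ k → m v s = c s)
    (hmv' : ∀ s ∈ U, s ≠ v → s ≠ k → m s v = c s) :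
    ∃ φ ∈ A.derivations, ∃ q, φ (linForm (x v - x k)) =
      linForm (x v - x k) ^ b * (restrictionForm U x v k c + linForm (x v - x k) * q) := by
  set B := linForm (x v - x k) ^ b *
    ∏ s ∈ (U.erase v).erase k, linForm (x v - x s) ^ c s with hB
  obtain ⟨φ, hφ⟩ := hx.exists_derivation (Pi.single v B)
  have hdvd : ∀ s ∈ U, s ≠ v → linForm (x v - x s) ^ m v s ∣ B := by
    intro s hs hsv
    by_cases hsk : s = k
    · rw [hsk, hm]; exact dvd_mul_right _ _
    · rw [hmv s hs hsv hsk]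
      exact (Finset.dvd_prod_of_mem (fun s => linForm (x v - x s) ^ c s)
        (by simp [hs, hsv, hsk])).mul_left _
  have hsymm : ∀ s ∈ U, s ≠ v → m s v = m v s := by
    intro s hs hsv
    by_cases hsk : s = k
    · rw [hsk, hm, hm']
    · rw [hmv s hs hsv hsk, hmv' s hs hsv hsk]
  refine ⟨φ, (hA.mem_derivations hx).2 fun i hi j hj hij => ?_, ?_⟩
  · rw [hφ i hi j hj]
    by_cases hiv : i = v
    · subst hiv
      rw [Pi.single_eq_same, Pi.single_eq_of_ne hij.symm, sub_zero]
      exact hdvd j hj hij.symm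
    · rw [Pi.single_eq_of_ne hiv]
      by_cases hjv : j = v
      · subst hjv
        rw [Pi.single_eq_same, zero_sub, dvd_neg, hsymm i hi hij, ← neg_sub (x j) (x i), linForm,
          map_neg, neg_pow, ((isUnit_one.neg).pow _).mul_left_dvd]
        exact hdvd i hi hij
      · rw [Pi.single_eq_of_ne hjv, sub_zero]
        exact dvd_zero _
  · obtain ⟨w, hw⟩ := hx (Pi.single v 1)
    have hαw : (x v - x k) w = 1 := by rw [hw v hv k hk]; simp [hvk.symm]
    have h1 : linForm (x v - x k) ∣ (∏ s ∈ (U.erase v).erase k, linForm (x v - x s) ^ c s) -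
        restrictionForm U x v k c := by
      rw [linForm_dvd_iff hαw, map_sub, restrictionForm, map_prod, map_prod, sub_eq_zero]
      refine Finset.prod_congr rfl fun s hs => ?_
      simp only [Finset.mem_erase] at hs
      rw [map_pow, map_pow, projectHom_linForm, projectHom_linForm, hw v hv s hs.2.2,
        hw k hk s hs.2.2]
      simp [hs.2.1, hvk.symm]
    obtain ⟨q, hq⟩ := h1
    refine ⟨q, ?_⟩
    rw [hφ v hv k hk, Pi.single_eq_same, Pi.single_eq_of_ne hvk.symm, hB]
    linear_combination linForm (x v - x k) ^ b * hq

-- The derivation sends x_i to P(x_i), where P' = ∏ (t - x_s)^(c s). Its value on x_i - x_j is the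
-- integral of P' from x_j to x_i, which is divisible by (x_i - x_j)^(c_i + c_j + 1); the leading
-- term is the product of the remaining factors at t = x_j, times a Beta integral.
open Polynomial in
theorem exists_leading_derivation_of_integral [CharZero K] (hA : A.IsWeighted U x m)
    (hx : IsFrame U x) {v k : ι} (hv : v ∈ U) (hk : k ∈ U) (hvk : v ≠ k) (c : ι → ℕ)
    (hm : ∀ i ∈ U, ∀ j ∈ U, i ≠ j → m i j ≤ c i + c j + 1) :
    ∃ φ ∈ A.derivations, ∃ κ : K, κ ≠ 0 ∧ ∃ q, φ (linForm (x v - x k)) =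
      linForm (x v - x k) ^ (c v + c k + 1) *
        (algebraMap K _ κ * restrictionForm U x v k c + linForm (x v - x k) * q) := by
  obtain ⟨P, hP⟩ := exists_derivative_eq K
    (∏ s ∈ U, ((X : (PolyRing K V)[X]) - C (linForm (x s))) ^ c s)
  obtain ⟨φ, hφ⟩ := hx.exists_derivation fun i => P.eval (linForm (x i))
  have hfactor : ∀ i ∈ U, ∀ j ∈ U, i ≠ j → derivative P = (X - C (linForm (x j))) ^ c j *
      (X - C (linForm (x i))) ^ c i *
        ∏ s ∈ (U.erase i).erase j, (X - C (linForm (x s))) ^ c s := by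
    intro i hi j hj hij
    rw [hP, ← Finset.mul_prod_erase U _ hi,
      ← Finset.mul_prod_erase (U.erase i) _ (Finset.mem_erase.2 ⟨hij.symm, hj⟩)]
    ring
  refine ⟨φ, (hA.mem_derivations hx).2 fun i hi j hj hij => ?_, ?_⟩
  · obtain ⟨κ, -, h⟩ := exists_eval_sub_eval_eq K (R := PolyRing K V) (c j) (c i)
    obtain ⟨s, hs⟩ := h _ _ P _ (hfactor i hi j hj hij)
    rw [hφ i hi j hj, hs, linForm_sub]
    exact (pow_dvd_pow _ ((hm i hi j hj hij).trans (by omega))).trans (dvd_mul_right _ _)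
  · obtain ⟨κ, hκ, h⟩ := exists_eval_sub_eval_eq K (R := PolyRing K V) (c k) (c v)
    obtain ⟨s, hs⟩ := h _ _ P _ (hfactor v hv k hk hvk)
    refine ⟨κ, hκ, s, ?_⟩
    rw [hφ v hv k hk, hs, linForm_sub, add_comm (c v), restrictionForm, eval_prod]
    simp only [eval_pow, eval_sub, eval_X, eval_C, linForm_sub]

end Multiarrangement

namespace Multiarrangement

/-! ### Multiplicities from vertex weights and a graph. -/

section Weight

variable {ι : Type*}

open Classical in
/-- `1` for adjacent vertices, `0` otherwise. -/
noncomputable def adjCount (G : SimpleGraph ι) (i j : ι) : ℕ := if G.Adj i j then 1 else 0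

theorem adjCount_of_adj {G : SimpleGraph ι} {i j : ι} (h : G.Adj i j) : adjCount G i j = 1 :=
  if_pos h

theorem adjCount_of_not_adj {G : SimpleGraph ι} {i j : ι} (h : ¬ G.Adj i j) :
    adjCount G i j = 0 := if_neg h

theorem adjCount_le_one (G : SimpleGraph ι) (i j : ι) : adjCount G i j ≤ 1 := by
  unfold adjCount; split_ifs <;> simp

theorem adjCount_comm (G : SimpleGraph ι) (i j : ι) : adjCount G i j = adjCount G j i := by
  unfold adjCount
  congr 1
  exact propext (G.adj_comm i j)

theorem adjCount_mono {G : SimpleGraph ι} {i j a b : ι} (h : G.Adj i j → G.Adj a b) :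
    adjCount G i j ≤ adjCount G a b := by
  by_cases hij : G.Adj i j
  · rw [adjCount_of_adj hij, adjCount_of_adj (h hij)]
  · rw [adjCount_of_not_adj hij]; exact Nat.zero_le _

/-- The multiplicity `n i + n j`, raised by one at the edges of `G`. -/
noncomputable def weight (n : ι → ℕ) (G : SimpleGraph ι) (i j : ι) : ℕ :=
  n i + n j + adjCount G i j

theorem weight_comm (n : ι → ℕ) (G : SimpleGraph ι) (i j : ι) :
    weight n G i j = weight n G j i := by
  rw [weight, weight, adjCount_comm, add_comm (n i)]

theorem adjCount_deleteEdges_self (G : SimpleGraph ι) (v k : ι) :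
    adjCount (G.deleteEdges {s(v, k)}) v k = 0 :=
  adjCount_of_not_adj (by simp)

theorem adjCount_deleteEdges_of_ne (G : SimpleGraph ι) {v k i j : ι} (h : s(i, j) ≠ s(v, k)) :
    adjCount (G.deleteEdges {s(v, k)}) i j = adjCount G i j := by
  unfold adjCount
  congr 1
  simp only [SimpleGraph.deleteEdges_adj, Set.mem_singleton_iff, h, not_false_eq_true, and_true]

end Weight

/-! ### Bases that contain prescribed constant derivations. -/

section Bases

variable {K : Type u} {V : Type v} [Field K] [AddCommGroup V] [Module K V]

/-- `D(𝒜, ν)` has a basis that consists of homogeneous derivations whose degrees form `E` and of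
the constant derivations in the directions `y`. -/
def HasBasisWith (A : Multiarrangement K V) {c : ℕ} (y : Fin c → V) (E : Multiset ℕ) : Prop :=
  ∃ (k : ℕ) (b : Fin k ⊕ Fin c → PolyDer K V) (d : Fin k → ℕ), IsBasisOf b A.derivations ∧
    (∀ i, HasPdeg (b (Sum.inl i)) (d i)) ∧ (∀ j, b (Sum.inr j) = directional (y j)) ∧
    Finset.univ.val.map d = E

theorem hasPdeg_directional (w : V) : HasPdeg (directional w : PolyDer K V) 0 := fun α => by
  rw [directional_linForm]
  exact algebraMap_mem_homogeneousPart _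

theorem HasBasisWith.hasExponents {A : Multiarrangement K V} {c : ℕ} {y : Fin c → V}
    {E : Multiset ℕ} (h : A.HasBasisWith y E) :
    A.HasExponents (E + Multiset.replicate c 0) := by
  obtain ⟨k, b, d, hb, hd, hy, rfl⟩ := h
  obtain ⟨b', hb'⟩ := (hb.reindex finSumFinEquiv.symm).exists_basis
  refine ⟨k + c, b', Sum.elim d (fun _ => 0) ∘ finSumFinEquiv.symm, fun i => ?_, ?_⟩
  · rw [hb']
    obtain ⟨i, rfl⟩ := finSumFinEquiv.surjective i
    simp only [Function.comp_apply, Equiv.symm_apply_apply]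
    cases i with
    | inl i => exact hd i
    | inr j => rw [hy]; exact hasPdeg_directional _
  · rw [← Multiset.map_map, ← Multiset.map_univ_val_equiv finSumFinEquiv, Multiset.map_map,
      Multiset.map_map]
    simp only [Function.comp_def, Equiv.symm_apply_apply]
    rw [← Finset.univ_disjSum_univ, Finset.val_disjSum, Multiset.disjSum, Multiset.map_add,
      Multiset.map_map, Multiset.map_map]
    simp [Function.comp_def]

theorem isBasisOf_directional {J : Type*} [Fintype J] (e : Basis J K V) :
    IsBasisOf (fun j => (directional (e j) : PolyDer K V))
      (⊤ : Submodule (PolyRing K V) (PolyDer K V)) := by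
  classical
  constructor
  · rw [Fintype.linearIndependent_iff]
    intro g hg i
    have h := congrArg (fun θ : PolyDer K V => θ (linForm (e.coord i))) hg
    beta_reduce at h
    rw [Derivation.zero_apply] at h
    simpa [sum_derivation_apply, Finsupp.single_apply] using h
  · rw [eq_top_iff]
    intro θ _
    rw [Submodule.mem_span_range_iff_exists_fun]
    refine ⟨fun j => θ (linForm (e.coord j)), derivation_ext fun α => ?_⟩
    have hα : α = ∑ j, α (e j) • e.coord j := by
      apply e.ext
      intro i
      simp
    rw [sum_derivation_apply]
    conv_rhs => rw [hα]
    simp only [linForm, map_sum, LinearMap.map_smul, Derivation.smul_apply, smul_eq_mul]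
    refine Finset.sum_congr rfl fun j _ => ?_
    have := directional_linForm (e j) α
    rw [linForm] at this
    rw [this, Derivation.map_smul, Algebra.smul_def, mul_comm]

theorem exists_basis_extending [FiniteDimensional K V] {W : Submodule K V} {c : ℕ}
    (y : Basis (Fin c) K W) {k : ℕ} (hk : finrank K V = k + c) :
    ∃ e : Basis (Fin k ⊕ Fin c) K V, ∀ j, e (Sum.inr j) = y j := by
  obtain ⟨W', hW'⟩ := W.exists_isCompl
  have h1 := Submodule.finrank_add_eq_of_isCompl hW'
  rw [finrank_eq_card_basis y, Fintype.card_fin, hk] at h1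
  let e' := finBasisOfFinrankEq K W' (show finrank K W' = k by omega)
  refine ⟨(e'.prod y).map (Submodule.prodEquivOfIsCompl W' W hW'.symm), fun j => ?_⟩
  simp

end Bases

/-! ### The center, and the effect of an edge on a basis. -/

section Frame

variable {K : Type u} {V : Type v} [Field K] [AddCommGroup V] [Module K V]
variable {ι : Type*} {A : Multiarrangement K V} {U : Finset ι} {x : ι → Dual K V}

/-- The directions in which all `x i`, `i ∈ U`, change alike. -/
def frameCenter (U : Finset ι) (x : ι → Dual K V) : Submodule K V :=
  ⨅ i ∈ U, ⨅ j ∈ U, LinearMap.ker (x i - x j)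

theorem mem_frameCenter {w : V} :
    w ∈ frameCenter U x ↔ ∀ i ∈ U, ∀ j ∈ U, (x i - x j) w = 0 := by
  simp [frameCenter, Submodule.mem_iInf]

/-- The differences with one fixed x_i map V onto a space of dimension |U| - 1 with the center as
kernel. For empty U the truncated difference is 0 and the center is V. -/
theorem finrank_eq_add_finrank_frameCenter [FiniteDimensional K V] [DecidableEq ι]
    (hx : IsFrame U x) : finrank K V = (U.card - 1) + finrank K (frameCenter U x) := by
  rcases U.eq_empty_or_nonempty with rfl | ⟨i₀, hi₀⟩
  · have : frameCenter (∅ : Finset ι) x = ⊤ := by simp [frameCenter]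
    rw [this]; simp
  · let f : V →ₗ[K] (U.erase i₀ → K) := LinearMap.pi fun i => x i - x i₀
    have hker : LinearMap.ker f = frameCenter U x := by
      ext w
      rw [mem_frameCenter, LinearMap.mem_ker]
      constructor
      · intro h
        have h' : ∀ i ∈ U, x i w = x i₀ w := by
          intro i hi
          by_cases hii : i = i₀
          · rw [hii]
          · exact sub_eq_zero.1 (congrFun h ⟨i, Finset.mem_erase.2 ⟨hii, hi⟩⟩)
        intro i hi j hj
        rw [LinearMap.sub_apply, h' i hi, h' j hj, sub_self]
      · intro h
        ext i
        exact h i (Finset.mem_of_mem_erase i.2) i₀ hi₀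
    have hsurj : LinearMap.range f = ⊤ := by
      rw [LinearMap.range_eq_top]
      intro g
      obtain ⟨w, hw⟩ := hx fun i => if h : i ∈ U.erase i₀ then g ⟨i, h⟩ else 0
      refine ⟨w, ?_⟩
      ext i
      have := hw i (Finset.mem_of_mem_erase i.2) i₀ hi₀
      simpa [f] using this
    rw [← LinearMap.finrank_range_add_finrank_ker f, hker, hsurj, finrank_top,
      finrank_fintype_fun_eq_card]
    simp [Finset.card_erase_of_mem hi₀]

theorem hasBasisWith_empty [FiniteDimensional K V] [DecidableEq ι] (hx : IsFrame U x)
    {c : ℕ} (y : Basis (Fin c) K (frameCenter U x)) :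
    (empty K V).HasBasisWith (fun j => (y j : V)) (Multiset.replicate (U.card - 1) 0) := by
  have hk := finrank_eq_add_finrank_frameCenter hx
  rw [finrank_eq_card_basis y, Fintype.card_fin] at hk
  obtain ⟨e, he⟩ := exists_basis_extending y hk
  have htop : (empty K V).derivations = ⊤ := by
    rw [eq_top_iff]
    intro θ _ H hH
    exact absurd rfl hH
  refine ⟨U.card - 1, fun j => directional (e j), fun _ => 0, ?_, fun i => hasPdeg_directional _,
    fun j => ?_, ?_⟩
  · rw [htop]; exact isBasisOf_directional e
  · beta_reduce; rw [he]
  · simp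

theorem IsWeighted.eq_empty {m : ι → ι → ℕ} (hA : A.IsWeighted U x m)
    (h : ∀ i ∈ U, ∀ j ∈ U, i ≠ j → m i j = 0) : A = empty K V := by
  ext H
  change A.mult H = 0
  by_contra h0
  obtain ⟨i, hi, j, hj, hij, rfl⟩ := hA.exists_of_mult_ne_zero H h0
  exact h0 ((hA.mult_ker i hi j hj hij).trans (h i hi j hj hij))

variable [DecidableEq ι] {n : ι → ℕ} {G : SimpleGraph ι} {v k : ι}

/-- In a frame different pairs of vertices have different hyperplanes, so lowering one multiplicity
deletes exactly one edge. -/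
theorem IsWeighted.deletion (hA : A.IsWeighted U x (weight n G)) (hx : IsFrame U x)
    (hv : v ∈ U) (hk : k ∈ U) (hG : G.Adj v k) :
    (A.deletion (LinearMap.ker (x v - x k))).IsWeighted U x
      (weight n (G.deleteEdges {s(v, k)})) := by
  constructor
  · intro i hi j hj hij
    by_cases h : LinearMap.ker (x i - x j) = LinearMap.ker (x v - x k)
    · have hs : s(i, j) = s(v, k) := by
        rw [Sym2.eq_iff]
        exact hx.eq_or_eq_of_ker_eq hv hk hi hj hG.ne hij h
      rw [h, deletion_mult_self, hA.mult_ker v hv k hk hG.ne, weight, adjCount_of_adj hG, weight]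
      have : adjCount (G.deleteEdges {s(v, k)}) i j = 0 :=
        adjCount_of_not_adj (by simp [hs])
      rw [this]
      rcases Sym2.eq_iff.1 hs with ⟨rfl, rfl⟩ | ⟨rfl, rfl⟩ <;> omega
    · rw [deletion_mult_of_ne A h, hA.mult_ker i hi j hj hij, weight, weight,
        adjCount_deleteEdges_of_ne]
      intro hs
      apply h
      rcases Sym2.eq_iff.1 hs with ⟨rfl, rfl⟩ | ⟨rfl, rfl⟩
      · rfl
      · rw [← neg_sub, LinearMap.ker_neg]
  · intro H hH
    refine hA.exists_of_mult_ne_zero H fun h0 => hH ?_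
    have := deletion_mult_le A (LinearMap.ker (x v - x k)) H
    omega

/-- The degree of the basis member of the deletion that is affected by the edge `v k`. -/
noncomputable def edgeDegree (U : Finset ι) (n : ι → ℕ) (G : SimpleGraph ι) (v k : ι) : ℕ :=
  n v + n k + ∑ s ∈ (U.erase v).erase k, (n s + adjCount G v s)

/-- This supplies the φ required by `exists_basis_of_deletion`, from the single moving vertex if v
has weight 0 and from an integral otherwise. -/
theorem exists_leading_derivation [CharZero K] {A' : Multiarrangement K V}
    (hA : A'.IsWeighted U x (weight n (G.deleteEdges {s(v, k)}))) (hx : IsFrame U x)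
    (hv : v ∈ U) (hk : k ∈ U) (hG : G.Adj v k) :
    ∃ φ ∈ A'.derivations, ∃ κ : K, κ ≠ 0 ∧ ∃ q, φ (linForm (x v - x k)) =
      linForm (x v - x k) ^ (n v + n k) *
        (algebraMap K _ κ * restrictionForm U x v k (fun s => n s + adjCount G v s) +
          linForm (x v - x k) * q) := by
  have hvs : ∀ s, s ≠ k → adjCount (G.deleteEdges {s(v, k)}) v s = adjCount G v s := by
    intro s hs
    refine adjCount_deleteEdges_of_ne G fun h => ?_
    rcases Sym2.eq_iff.1 h with h | h
    · exact hs h.2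
    · exact hG.ne h.1
  have hvk := adjCount_deleteEdges_self G v k
  rcases Nat.eq_zero_or_eq_succ_pred (n v) with h0 | h0
  · obtain ⟨φ, hφ, q, hq⟩ := exists_leading_derivation_of_eq_zero hA hx hv hk hG.ne
      (b := n v + n k) (fun s => n s + adjCount G v s)
      (by rw [weight, hvk, add_zero])
      (by rw [weight_comm, weight, hvk, add_zero])
      (fun s _ _ hsk => by rw [weight, hvs s hsk, h0, zero_add])
      (fun s _ _ hsk => by rw [weight_comm, weight, hvs s hsk, h0, zero_add])
    exact ⟨φ, hφ, 1, one_ne_zero, q, by rw [hq, map_one, one_mul]⟩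
  -- The exponent of (x_v - x_k) will be c_v + c_k + 1, which has to equal n_v + n_k. This forces
  -- c_v = n_v - 1 and is why n_v = 0 is a separate case.
  · set c : ι → ℕ := fun s => if s = v then n v - 1 else
      n s + adjCount (G.deleteEdges {s(v, k)}) v s with hc
    have hcv : c v = n v - 1 := if_pos rfl
    have hcs : ∀ s, s ≠ v → c s = n s + adjCount (G.deleteEdges {s(v, k)}) v s :=
      fun s hs => if_neg hs
    have hnv : 1 ≤ n v := by omega
    obtain ⟨φ, hφ, κ, hκ, q, hq⟩ := exists_leading_derivation_of_integral hA hx hv hk hG.ne c (by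
      intro i hi j hj hij
      have hle := adjCount_le_one (G.deleteEdges {s(v, k)}) i j
      rw [weight]
      by_cases hiv : i = v
      · subst hiv
        rw [hcv, hcs j hij.symm]
        omega
      · by_cases hjv : j = v
        · subst hjv
          rw [hcv, hcs i hij, adjCount_comm _ i j]
          omega
        · rw [hcs i hiv, hcs j hjv]
          omega)
    refine ⟨φ, hφ, κ, hκ, q, ?_⟩
    have hB : restrictionForm U x v k c =
        restrictionForm U x v k fun s => n s + adjCount G v s := by
      refine Finset.prod_congr rfl fun s hs => ?_
      simp only [Finset.mem_erase] at hs
      rw [hcs s hs.2.1, hvs s hs.1]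
    rw [hq, hB, hcv, hcs k hG.ne.symm, hvk, show n v - 1 + (n k + 0) + 1 = n v + n k by omega]

/-- The effect of an edge at a vertex `v`, all of whose other neighbours are adjacent to `k`, on
a homogeneous basis. -/
theorem exists_basis_of_edge [CharZero K] (hA : A.IsWeighted U x (weight n G)) (hx : IsFrame U x)
    (hv : v ∈ U) (hk : k ∈ U) (hG : G.Adj v k)
    (hsimp : ∀ s ∈ U, s ≠ k → G.Adj v s → G.Adj k s) {l c : ℕ}
    {b : Fin l ⊕ Fin c → PolyDer K V} {d : Fin l → ℕ} {y : Fin c → V}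
    (hb : IsBasisOf b (A.deletion (LinearMap.ker (x v - x k))).derivations)
    (hd : ∀ i, HasPdeg (b (Sum.inl i)) (d i)) (hby : ∀ j, b (Sum.inr j) = directional (y j))
    (hy : ∀ j, (x v - x k) (y j) = 0) :
    ∃ i₀, d i₀ = edgeDegree U n G v k ∧ ∃ b' : Fin l ⊕ Fin c → PolyDer K V,
      IsBasisOf b' A.derivations ∧ (∀ j, b' (Sum.inr j) = directional (y j)) ∧
      b' (Sum.inl i₀) = linForm (x v - x k) • b (Sum.inl i₀) ∧
      (∀ i, i ≠ i₀ → HasPdeg (b' (Sum.inl i)) (d i) ∧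
        ∃ q : PolyRing K V, b' (Sum.inl i) = b (Sum.inl i) - q • b (Sum.inl i₀)) := by
  have hA' := hA.deletion hx hv hk hG
  have hvs : ∀ i s, i = v ∨ i = k → s ≠ v → s ≠ k →
      adjCount (G.deleteEdges {s(v, k)}) i s = adjCount G i s := by
    intro i s hi hsv hsk
    refine adjCount_deleteEdges_of_ne G fun h => ?_
    rcases Sym2.eq_iff.1 h with h | h
    · exact hsk h.2
    · exact hsv h.2
  have hμ : A.mult (LinearMap.ker (x v - x k)) = n v + n k + 1 := by
    rw [hA.mult_ker v hv k hk hG.ne, weight, adjCount_of_adj hG]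
  have hd' : ∀ j, HasPdeg (b j) (Sum.elim d (fun _ => 0) j) := by
    rintro (i | j)
    · exact hd i
    · rw [hby]; exact hasPdeg_directional _
  obtain ⟨j₀, hj₀, hne, q, hq₀, hq, hdeg, hbasis⟩ := exists_basis_of_deletion hμ hb hd'
    (restrictionForm_mem U x v k fun s => n s + adjCount G v s)
    (not_dvd_restrictionForm hx hv hk hG.ne _)
    (fun θ hθ => exists_eq_mul_restrictionForm hA' hx hv hk hG.ne _
      (by rw [weight, adjCount_deleteEdges_self, add_zero])
      (fun s hs hsv hsk => by rw [weight, hvs v s (Or.inl rfl) hsv hsk, add_assoc])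
      (fun s hs hsv hsk => by
        rw [weight, hvs k s (Or.inr rfl) hsv hsk, add_assoc]
        have := adjCount_mono (hsimp s hs hsk)
        -- Here the clique condition enters: k is adjacent to every s that is adjacent to v, so the
        -- multiplicity at ks is at least n_k + n_s + [vs is an edge].
        omega) hθ)
    (exists_leading_derivation hA' hx hv hk hG)
  -- The constant derivations in the list kill x_v - x_k; they are neither chosen as the member to
  -- be multiplied nor corrected.
  have hinr : ∀ j, b (Sum.inr j) (linForm (x v - x k)) = 0 := by
    intro j
    rw [hby, directional_linForm, hy, map_zero]
  rcases j₀ with i₀ | j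
  · refine ⟨i₀, hj₀, _, hbasis, fun j => ?_, ?_, fun i hi => ⟨?_, q (Sum.inl i), ?_⟩⟩
    · simp [hq _ (hinr j), hby]
    · simp [hq₀]
    · simpa [hi] using hdeg (Sum.inl i)
    · simp [hi]
  · exact absurd (hinr j) hne

theorem map_update_add_one {l : ℕ} (d : Fin l → ℕ) (i₀ : Fin l) {T : Multiset ℕ}
    (h : Finset.univ.val.map d = d i₀ ::ₘ T) :
    Finset.univ.val.map (Function.update d i₀ (d i₀ + 1)) = (d i₀ + 1) ::ₘ T := by
  have hu : (Finset.univ : Finset (Fin l)).val = i₀ ::ₘ (Finset.univ.erase i₀).val := by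
    rw [← Finset.insert_val_of_notMem (Finset.notMem_erase _ _),
      Finset.insert_erase (Finset.mem_univ _)]
  rw [hu, Multiset.map_cons] at h ⊢
  rw [Function.update_self]
  congr 1
  rw [← (Multiset.cons_inj_right _).1 h]
  refine Multiset.map_congr rfl fun j hj => ?_
  rw [Function.update_of_ne]
  exact Finset.ne_of_mem_erase (Finset.mem_val ▸ hj)

theorem HasBasisWith.of_edge [CharZero K] (hA : A.IsWeighted U x (weight n G))
    (hx : IsFrame U x) (hv : v ∈ U) (hk : k ∈ U) (hG : G.Adj v k)
    (hsimp : ∀ s ∈ U, s ≠ k → G.Adj v s → G.Adj k s) {c : ℕ} {y : Fin c → V}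
    (hy : ∀ j, (x v - x k) (y j) = 0) {T : Multiset ℕ}
    (h : (A.deletion (LinearMap.ker (x v - x k))).HasBasisWith y (edgeDegree U n G v k ::ₘ T)) :
    A.HasBasisWith y ((edgeDegree U n G v k + 1) ::ₘ T) := by
  obtain ⟨l, b, d, hb, hd, hby, hE⟩ := h
  obtain ⟨i₀, hi₀, b', hb', hby', hbi₀, hbi⟩ :=
    exists_basis_of_edge hA hx hv hk hG hsimp hb hd hby hy
  refine ⟨l, b', Function.update d i₀ (d i₀ + 1), hb', fun i => ?_, hby', ?_⟩
  · by_cases hi : i = i₀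
    · subst hi
      rw [Function.update_self, hbi₀]
      intro β
      rw [Derivation.smul_apply, smul_eq_mul, add_comm]
      exact mul_mem_homogeneousPart (linForm_mem_homogeneousPart _) (hd i β)
    · rw [Function.update_of_ne hi]
      exact (hbi i hi).1
  · rw [← hi₀] at hE ⊢
    exact map_update_add_one d i₀ hE

end Frame

end Multiarrangement

/-! ### Perfect elimination orderings and exponents. -/

namespace Multiarrangement

variable {ι : Type*}

/-- The rank function `r` is a perfect elimination ordering of `G` on `U`: the neighbours of
smaller rank of each vertex form a clique. -/
structure IsPerfectElimination (U : Finset ι) (G : SimpleGraph ι) (r : ι → ℕ) : Prop where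
  injOn : Set.InjOn r U
  adj : ∀ v ∈ U, ∀ u ∈ U, ∀ w ∈ U, r u < r v → r w < r v → G.Adj v u → G.Adj v w → u ≠ w →
    G.Adj u w

open Classical in
/-- The number of neighbours of smaller rank. -/
noncomputable def backDegree (U : Finset ι) (G : SimpleGraph ι) (r : ι → ℕ) (v : ι) : ℕ :=
  (U.filter fun u => r u < r v ∧ G.Adj v u).card

/-- The sum of the weights and the back degree of a vertex, for all but one vertex of back
degree `0`. -/
noncomputable def eliminationExponents (U : Finset ι) (n : ι → ℕ) (G : SimpleGraph ι)
    (r : ι → ℕ) : Multiset ℕ :=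
  (U.val.map fun v => ∑ i ∈ U, n i + backDegree U G r v).erase (∑ i ∈ U, n i)

theorem backDegree_eq_zero {U : Finset ι} {G : SimpleGraph ι} {r : ι → ℕ} {v : ι}
    (h : ∀ u ∈ U, r u < r v → ¬ G.Adj v u) : backDegree U G r v = 0 := by
  classical
  rw [backDegree, Finset.card_eq_zero, Finset.filter_eq_empty_iff]
  exact fun u hu h' => h u hu h'.1 h'.2

theorem eliminationExponents_of_no_edges {U : Finset ι} {n : ι → ℕ} {G : SimpleGraph ι}
    {r : ι → ℕ} (hG : ∀ i ∈ U, ∀ j ∈ U, ¬ G.Adj i j) :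
    eliminationExponents U n G r = Multiset.replicate (U.card - 1) (∑ i ∈ U, n i) := by
  have h1 : U.val.map (fun v => ∑ i ∈ U, n i + backDegree U G r v) =
      Multiset.replicate U.card (∑ i ∈ U, n i) := by
    rw [Finset.card_def, ← Multiset.map_const']
    refine Multiset.map_congr rfl fun v hv => ?_
    rw [backDegree_eq_zero fun u hu _ => hG v hv u hu, add_zero]
  rw [eliminationExponents, h1]
  cases U.card with
  | zero => simp
  | succ k => rw [Multiset.replicate_succ, Multiset.erase_cons_head, Nat.add_sub_cancel]

section Star

/-- The edges that join `i` to all other vertices. -/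
def starGraph (i : ι) : SimpleGraph ι := SimpleGraph.fromRel fun a _ => a = i

theorem starGraph_adj {i a b : ι} : (starGraph i).Adj a b ↔ a ≠ b ∧ (a = i ∨ b = i) :=
  SimpleGraph.fromRel_adj _ _ _

variable [DecidableEq ι]

/-- The ranks `r`, with `i` moved to the front. -/
def frontRank (r : ι → ℕ) (i a : ι) : ℕ := if a = i then 0 else r a + 1

theorem frontRank_self (r : ι → ℕ) (i : ι) : frontRank r i i = 0 := if_pos rfl

theorem frontRank_of_ne (r : ι → ℕ) {i a : ι} (h : a ≠ i) : frontRank r i a = r a + 1 := if_neg h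

/-- With the center of the star in front, no vertex has more than one earlier neighbour, so the
clique condition is void. -/
theorem isPerfectElimination_starGraph {U : Finset ι} {r : ι → ℕ} (hr : Set.InjOn r U) (i : ι) :
    IsPerfectElimination U (starGraph i) (frontRank r i) := by
  constructor
  · intro a ha b hb hab
    by_cases hai : a = i <;> by_cases hbi : b = i
    · rw [hai, hbi]
    · rw [hai, frontRank_self, frontRank_of_ne r hbi] at hab; omega
    · rw [hbi, frontRank_self, frontRank_of_ne r hai] at hab; omega
    · rw [frontRank_of_ne r hai, frontRank_of_ne r hbi] at hab
      exact hr ha hb (by omega)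
  · intro v hv u hu w hw hruv hrwv hvu hvw huw
    rw [starGraph_adj] at *
    have hvi : v ≠ i := by
      rintro rfl
      rw [frontRank_self] at hruv
      omega
    have hu' := hvu.2.resolve_left hvi
    exact ⟨huw, Or.inl hu'⟩

theorem eliminationExponents_starGraph {U : Finset ι} {n : ι → ℕ} {r : ι → ℕ} {i : ι}
    (hi : i ∈ U) :
    eliminationExponents U n (starGraph i) (frontRank r i) =
      Multiset.replicate (U.card - 1) (∑ j ∈ U, n j + 1) := by
  classical
  have hU : U.val = i ::ₘ (U.erase i).val := by
    rw [← Finset.insert_val_of_notMem (Finset.notMem_erase _ _), Finset.insert_erase hi]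
  have h0 : backDegree U (starGraph i) (frontRank r i) i = 0 := by
    apply backDegree_eq_zero
    intro u _ h
    rw [frontRank_self] at h
    omega
  have h1 : (U.erase i).val.map (fun v =>
      ∑ j ∈ U, n j + backDegree U (starGraph i) (frontRank r i) v) =
      Multiset.replicate (U.card - 1) (∑ j ∈ U, n j + 1) := by
    rw [← Finset.card_erase_of_mem hi, Finset.card_def, ← Multiset.map_const']
    refine Multiset.map_congr rfl fun v hv => ?_
    have hv' : v ≠ i := Finset.ne_of_mem_erase (Finset.mem_val ▸ hv)
    congr 1
    rw [backDegree, Finset.card_eq_one]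
    refine ⟨i, ?_⟩
    ext u
    rw [Finset.mem_filter, Finset.mem_singleton, starGraph_adj]
    constructor
    · rintro ⟨-, -, -, h⟩
      exact h.resolve_left hv'
    · rintro rfl
      refine ⟨hi, ?_, hv', Or.inr rfl⟩
      rw [frontRank_self, frontRank_of_ne r hv']
      omega
  rw [eliminationExponents, hU, Multiset.map_cons, h0, add_zero, Multiset.erase_cons_head, h1]

end Star

section Edge

variable {U : Finset ι} {n : ι → ℕ} {G : SimpleGraph ι} {r : ι → ℕ}

/-- The vertex v is the last one with an earlier neighbour. A later neighbour of v would itself have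
v as an earlier neighbour. -/
theorem IsPerfectElimination.exists_simplicial (h : IsPerfectElimination U G r)
    (hG : ∃ i ∈ U, ∃ j ∈ U, G.Adj i j) :
    ∃ v ∈ U, ∃ k ∈ U, G.Adj v k ∧ (∀ u ∈ U, G.Adj v u → r u < r v) := by
  classical
  have hne : (U.filter fun v => ∃ u ∈ U, r u < r v ∧ G.Adj v u).Nonempty := by
    obtain ⟨i, hi, j, hj, hij⟩ := hG
    rcases lt_trichotomy (r i) (r j) with hr | hr | hr
    · exact ⟨j, Finset.mem_filter.2 ⟨hj, i, hi, hr, hij.symm⟩⟩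
    · exact absurd (h.injOn hi hj hr) hij.ne
    · exact ⟨i, Finset.mem_filter.2 ⟨hi, j, hj, hr, hij⟩⟩
  obtain ⟨v, hv, hmax⟩ := Finset.exists_max_image _ r hne
  obtain ⟨hvU, k, hk, -, hvk⟩ := Finset.mem_filter.1 hv
  refine ⟨v, hvU, k, hk, hvk, fun u hu huv => ?_⟩
  by_contra hlt
  have hlt' : r v < r u := lt_of_le_of_ne (not_lt.1 hlt) fun he => huv.ne (h.injOn hvU hu he)
  exact absurd (hmax u (Finset.mem_filter.2 ⟨hu, v, hvU, hlt', huv.symm⟩)) (not_le.2 hlt')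

variable {v k : ι}

/-- The edge vk could only be missed as a chord between earlier neighbours of some a; then a would
be a neighbour of v later than v. -/
theorem IsPerfectElimination.deleteEdges (h : IsPerfectElimination U G r)
    (hlast : ∀ u ∈ U, G.Adj v u → r u < r v) (hk : k ∈ U) (hvk : G.Adj v k) :
    IsPerfectElimination U (G.deleteEdges {s(v, k)}) r := by
  refine ⟨h.injOn, fun a ha u hu w hw hua hwa hau haw huw => ?_⟩
  rw [SimpleGraph.deleteEdges_adj] at *
  refine ⟨h.adj a ha u hu w hw hua hwa hau.1 haw.1 huw, fun hs => ?_⟩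
  have hkv := hlast k hk hvk
  rcases Sym2.eq_iff.1 (Set.mem_singleton_iff.1 hs) with ⟨rfl, rfl⟩ | ⟨rfl, rfl⟩
  · exact absurd (hlast a ha hau.1.symm) (by omega)
  · exact absurd (hlast a ha haw.1.symm) (by omega)

theorem exists_backDegree_eq_zero (hne : U.Nonempty) :
    ∃ i ∈ U, (∀ (G' : SimpleGraph ι), backDegree U G' r i = 0) ∧ ∀ j ∈ U, r i ≤ r j := by
  obtain ⟨i, hi, hmin⟩ := U.exists_min_image r hne
  refine ⟨i, hi, fun G' => backDegree_eq_zero fun u hu hlt => ?_, hmin⟩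
  have := hmin u hu
  omega

theorem backDegree_deleteEdges_of_ne (hlast : ∀ u ∈ U, G.Adj v u → r u < r v) (hk : k ∈ U)
    (hvk : G.Adj v k) {a : ι} (ha : a ≠ v) :
    backDegree U (G.deleteEdges {s(v, k)}) r a = backDegree U G r a := by
  have hkv := hlast k hk hvk
  rw [backDegree, backDegree]
  congr 1
  ext u
  simp only [Finset.mem_filter]
  refine and_congr_right fun hu => and_congr_right fun hlt => ?_
  rw [SimpleGraph.deleteEdges_adj, and_iff_left]
  rw [Set.mem_singleton_iff, Sym2.eq_iff]
  rintro (⟨rfl, rfl⟩ | ⟨rfl, rfl⟩)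
  · exact ha rfl
  · omega

variable [DecidableEq ι]

theorem IsPerfectElimination.erase (h : IsPerfectElimination U G r) (v : ι) :
    IsPerfectElimination (U.erase v) G r :=
  ⟨h.injOn.mono (Finset.coe_subset.2 (Finset.erase_subset _ _)), fun a ha u hu w hw =>
    h.adj a (Finset.mem_of_mem_erase ha) u (Finset.mem_of_mem_erase hu) w
      (Finset.mem_of_mem_erase hw)⟩

theorem sum_update_merge (hv : v ∈ U) (hk : k ∈ U) (hvk : v ≠ k) :
    ∑ i ∈ U.erase v, Function.update n k (n k + n v) i = ∑ i ∈ U, n i := by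
  have hk' : k ∈ U.erase v := Finset.mem_erase.2 ⟨hvk.symm, hk⟩
  rw [Finset.sum_update_of_mem hk', ← Finset.add_sum_erase U n hv,
    ← Finset.add_sum_erase _ n hk', Finset.sdiff_singleton_eq_erase]
  ring

theorem backDegree_deleteEdges_self (hlast : ∀ u ∈ U, G.Adj v u → r u < r v) (hk : k ∈ U)
    (hvk : G.Adj v k) :
    backDegree U (G.deleteEdges {s(v, k)}) r v + 1 = backDegree U G r v := by
  classical
  rw [backDegree, backDegree]
  have hmem : k ∈ U.filter fun u => r u < r v ∧ G.Adj v u :=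
    Finset.mem_filter.2 ⟨hk, hlast k hk hvk, hvk⟩
  rw [← Finset.card_erase_add_one hmem]
  congr 2
  ext u
  simp only [Finset.mem_filter, Finset.mem_erase, SimpleGraph.deleteEdges_adj,
    Set.mem_singleton_iff, Sym2.eq_iff, hvk.ne]
  grind

theorem backDegree_erase (hlast : ∀ u ∈ U, G.Adj v u → r u < r v) {a : ι} (ha : a ∈ U) :
    backDegree (U.erase v) G r a = backDegree U G r a := by
  classical
  rw [backDegree, backDegree]
  congr 1
  ext u
  simp only [Finset.mem_filter, Finset.mem_erase]
  constructor
  · tauto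
  · rintro ⟨hu, hlt, hadj⟩
    refine ⟨⟨?_, hu⟩, hlt, hadj⟩
    rintro rfl
    have := hlast a ha hadj.symm
    omega

theorem edgeDegree_eq (hv : v ∈ U) (hk : k ∈ U) (hvk : G.Adj v k)
    (hlast : ∀ u ∈ U, G.Adj v u → r u < r v) :
    edgeDegree U n G v k = ∑ i ∈ U, n i + backDegree U (G.deleteEdges {s(v, k)}) r v := by
  classical
  have hk' : k ∈ U.erase v := Finset.mem_erase.2 ⟨hvk.ne.symm, hk⟩
  have h1 : ∑ s ∈ (U.erase v).erase k, adjCount G v s =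
      backDegree U (G.deleteEdges {s(v, k)}) r v := by
    rw [backDegree, Finset.card_filter, ← Finset.add_sum_erase U _ hv,
      ← Finset.add_sum_erase _ _ hk']
    simp only [lt_self_iff_false, false_and, if_false, zero_add, SimpleGraph.deleteEdges_adj,
      Set.mem_singleton_iff, not_true, and_false]
    refine Finset.sum_congr rfl fun s hs => ?_
    simp only [Finset.mem_erase] at hs
    rw [adjCount]
    congr 1
    have : s(v, s) ≠ s(v, k) := by
      rw [Ne, Sym2.eq_iff]
      rintro (h | h)
      · exact hs.1 h.2
      · exact hvk.ne h.1
    simp only [this, not_false_eq_true, and_true, eq_iff_iff]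
    exact ⟨fun h => ⟨hlast s hs.2.2 h, h⟩, fun h => h.2⟩
  rw [edgeDegree, Finset.sum_add_distrib, h1, ← Finset.add_sum_erase U n hv,
    ← Finset.add_sum_erase _ n hk']
  ring

/-- Only the entry of v changes with the edge, by one. Merging v into k preserves the total weight
and the back degrees of the other vertices, so they contribute the same multiset T in all three
cases. -/
theorem eliminationExponents_edge (hv : v ∈ U) (hk : k ∈ U) (hvk : G.Adj v k)
    (hlast : ∀ u ∈ U, G.Adj v u → r u < r v) :
    eliminationExponents U n (G.deleteEdges {s(v, k)}) r = edgeDegree U n G v k ::ₘ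
        eliminationExponents (U.erase v) (Function.update n k (n k + n v)) G r ∧
      eliminationExponents U n G r = (edgeDegree U n G v k + 1) ::ₘ
        eliminationExponents (U.erase v) (Function.update n k (n k + n v)) G r := by
  have hU : U.val = v ::ₘ (U.erase v).val := by
    rw [← Finset.insert_val_of_notMem (Finset.notMem_erase _ _), Finset.insert_erase hv]
  obtain ⟨i, hi, hi0, hmin⟩ := exists_backDegree_eq_zero (r := r) ⟨v, hv⟩
  have hiv : i ≠ v := by
    rintro rfl
    have := hlast k hk hvk
    have := hmin k hk
    omega
  set N := ∑ i ∈ U, n i with hN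
  set M := (U.erase v).val.map fun a => N + backDegree U G r a with hM
  have hNM : N ∈ M := by
    rw [hM, Multiset.mem_map]
    exact ⟨i, Finset.mem_val ▸ Finset.mem_erase.2 ⟨hiv, hi⟩, by rw [hi0, add_zero]⟩
  have hT : eliminationExponents (U.erase v) (Function.update n k (n k + n v)) G r =
      M.erase N := by
    rw [eliminationExponents, sum_update_merge hv hk hvk.ne, ← hN, hM]
    congr 1
    refine Multiset.map_congr rfl fun a ha => ?_
    rw [backDegree_erase hlast (Finset.mem_of_mem_erase (Finset.mem_val ▸ ha))]
  -- The vertex of least rank differs from v and has back degree 0, so a copy of N can be erased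
  -- from the entries other than that of v.
  have hcons : ∀ d, (d ::ₘ M).erase N = d ::ₘ M.erase N := by
    intro d
    by_cases hd : d = N
    · rw [hd, Multiset.erase_cons_head, Multiset.cons_erase hNM]
    · rw [Multiset.erase_cons_tail _ hd]
  rw [hT, edgeDegree_eq hv hk hvk hlast, ← hN]
  constructor
  · rw [eliminationExponents, hU, Multiset.map_cons, ← hN, ← hcons]
    congr 2
    refine Multiset.map_congr rfl fun a ha => ?_
    rw [backDegree_deleteEdges_of_ne hlast hk hvk (Finset.ne_of_mem_erase (Finset.mem_val ▸ ha))]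
  · rw [eliminationExponents, hU, Multiset.map_cons, ← hN, ← hcons, add_assoc,
      backDegree_deleteEdges_self hlast hk hvk]

end Edge

/-! ### The induction scheme. -/

section Induction

variable [DecidableEq ι]

open Classical in
/-- The number of ordered pairs of adjacent vertices. -/
noncomputable def dartCount (U : Finset ι) (G : SimpleGraph ι) : ℕ :=
  ((U ×ˢ U).filter fun p => G.Adj p.1 p.2).card

theorem dartCount_deleteEdges_lt {U : Finset ι} {G : SimpleGraph ι} {v k : ι} (hv : v ∈ U)
    (hk : k ∈ U) (hvk : G.Adj v k) :
    dartCount U (G.deleteEdges {s(v, k)}) < dartCount U G := by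
  classical
  apply Finset.card_lt_card
  rw [Finset.ssubset_iff_of_subset]
  · refine ⟨(v, k), by simp [hv, hk, hvk], by simp⟩
  · intro p
    simp only [Finset.mem_filter, SimpleGraph.deleteEdges_adj]
    tauto

/-- The common skeleton for freeness and inductive freeness. The motive does not mention the
ordering, which only selects v and k and evaluates the exponents; freeness alone has no use for the
hypothesis on the merged graph. -/
theorem IsPerfectElimination.induction
    {motive : Finset ι → (ι → ℕ) → SimpleGraph ι → Multiset ℕ → Prop}
    (zero : ∀ U n G, (∀ i ∈ U, n i = 0) → (∀ i ∈ U, ∀ j ∈ U, ¬ G.Adj i j) →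
      motive U n G (Multiset.replicate (U.card - 1) 0))
    (shift : ∀ U n G i E, i ∈ U → n i ≠ 0 → (∀ i ∈ U, ∀ j ∈ U, ¬ G.Adj i j) →
      motive U (Function.update n i (n i - 1)) (starGraph i) E → motive U n G E)
    (edge : ∀ U n G v k T, v ∈ U → k ∈ U → G.Adj v k →
      (∀ s ∈ U, s ≠ k → G.Adj v s → G.Adj k s) →
      motive U n (G.deleteEdges {s(v, k)}) (edgeDegree U n G v k ::ₘ T) →
      motive (U.erase v) (Function.update n k (n k + n v)) G T →
      motive U n G ((edgeDegree U n G v k + 1) ::ₘ T))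
    (U : Finset ι) (n : ι → ℕ) (G : SimpleGraph ι) (r : ι → ℕ)
    (h : IsPerfectElimination U G r) : motive U n G (eliminationExponents U n G r) := by
  by_cases hG : ∃ i ∈ U, ∃ j ∈ U, G.Adj i j
  · obtain ⟨v, hv, k, hk, hvk, hlast⟩ := h.exists_simplicial hG
    obtain ⟨h1, h2⟩ := eliminationExponents_edge (n := n) hv hk hvk hlast
    have hlt := dartCount_deleteEdges_lt hv hk hvk
    have hcard := Finset.card_erase_lt_of_mem hv
    rw [h2]
    refine edge U n G v k _ hv hk hvk (fun s hs hsk hvs => ?_) ?_ ?_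
    · exact h.adj v hv k hk s hs (hlast k hk hvk) (hlast s hs hvs) hvk hvs hsk.symm
    · rw [← h1]
      exact IsPerfectElimination.induction zero shift edge U n _ r (h.deleteEdges hlast hk hvk)
    · exact IsPerfectElimination.induction zero shift edge _ _ G r (h.erase v)
  · push Not at hG
    by_cases hn : ∀ i ∈ U, n i = 0
    · rw [eliminationExponents_of_no_edges hG, Finset.sum_eq_zero hn]
      exact zero U n G hn hG
    · push Not at hn
      obtain ⟨i, hi, hni⟩ := hn
      have hsum : ∑ j ∈ U, Function.update n i (n i - 1) j + 1 = ∑ j ∈ U, n j := by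
        rw [Finset.sum_update_of_mem hi, Finset.sdiff_singleton_eq_erase,
          ← Finset.add_sum_erase U n hi]
        omega
      have hE : eliminationExponents U n G r = eliminationExponents U
          (Function.update n i (n i - 1)) (starGraph i) (frontRank r i) := by
        rw [eliminationExponents_of_no_edges hG, eliminationExponents_starGraph hi, hsum]
      have hlt : ∑ j ∈ U, Function.update n i (n i - 1) j < ∑ j ∈ U, n j := by omega
      rw [hE]
      exact shift U n G i _ hi hni hG (IsPerfectElimination.induction zero shift edge U _ _ _
        (isPerfectElimination_starGraph h.injOn i))
-- Merging removes a vertex, the shift to a star lowers the total weight while adding edges, and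
-- deletion lowers the number of edges alone; hence this lexicographic order.
termination_by (U.card, ∑ i ∈ U, n i, dartCount U G)
decreasing_by
  · exact Prod.Lex.right _ (Prod.Lex.right _ hlt)
  · exact Prod.Lex.left _ _ hcard
  · exact Prod.Lex.right _ (Prod.Lex.left _ _ hlt)

end Induction

/-! ### Freeness. -/

section Freeness

variable {K : Type u} {V : Type v} [Field K] [AddCommGroup V] [Module K V] [DecidableEq ι]

/-- The unit taken from the weight of i is returned by the edges of the star, which meet exactly the
pairs containing i. -/
theorem weight_shift {U : Finset ι} {n : ι → ℕ} {G : SimpleGraph ι} {i : ι} (hi : n i ≠ 0)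
    (hG : ∀ i ∈ U, ∀ j ∈ U, ¬ G.Adj i j) {a b : ι} (ha : a ∈ U) (hb : b ∈ U) (hab : a ≠ b) :
    weight n G a b = weight (Function.update n i (n i - 1)) (starGraph i) a b := by
  rw [weight, weight, adjCount_of_not_adj (hG a ha b hb)]
  by_cases hai : a = i
  · subst hai
    rw [adjCount_of_adj (starGraph_adj.2 ⟨hab, Or.inl rfl⟩), Function.update_self,
      Function.update_of_ne hab.symm]
    omega
  · rw [Function.update_of_ne hai]
    by_cases hbi : b = i
    · subst hbi
      rw [adjCount_of_adj (starGraph_adj.2 ⟨hab, Or.inr rfl⟩), Function.update_self]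
      omega
    · rw [Function.update_of_ne hbi, adjCount_of_not_adj fun h => ?_]
      exact (starGraph_adj.1 h).2.elim hai hbi

/-- Freeness of the braid-like multiarrangements of perfect elimination graphs. -/
theorem IsPerfectElimination.hasBasisWith [CharZero K] [FiniteDimensional K V] {U : Finset ι}
    {n : ι → ℕ} {G : SimpleGraph ι} {r : ι → ℕ} (h : IsPerfectElimination U G r)
    {A : Multiarrangement K V} {x : ι → Dual K V} (hx : IsFrame U x)
    (hA : A.IsWeighted U x (weight n G)) {c : ℕ} (y : Basis (Fin c) K (frameCenter U x)) :
    A.HasBasisWith (fun j => (y j : V)) (eliminationExponents U n G r) := by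
  refine h.induction (motive := fun U n G E => ∀ (A : Multiarrangement K V), IsFrame U x →
    A.IsWeighted U x (weight n G) → ∀ (y : Basis (Fin c) K (frameCenter U x)),
    A.HasBasisWith (fun j => (y j : V)) E) ?_ ?_ ?_ U n G r A hx hA y
  · intro U n G hn hG A hx hA y
    rw [hA.eq_empty fun i hi j hj _ => by
      rw [weight, hn i hi, hn j hj, adjCount_of_not_adj (hG i hi j hj)]]
    exact hasBasisWith_empty hx y
  · intro U n G i E hi hni hG ih A hx hA y
    exact ih A hx (hA.congr fun a ha b hb hab => weight_shift hni hG ha hb hab) y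
  · intro U n G v k T hv hk hvk hsimp ih _ A hx hA y
    exact HasBasisWith.of_edge hA hx hv hk hvk hsimp
      (fun j => mem_frameCenter.1 (y j).2 v hv k hk) (ih _ hx (hA.deletion hx hv hk hvk) y)

end Freeness

end Multiarrangement

namespace IsBasisOf

variable {R M J : Type*} [CommRing R] [IsDomain R] [AddCommGroup M] [Module R M] {v : J → M}

/-- Rescaling of the members of a basis. -/
theorem smul [Fintype J] {N N' : Submodule R M} (h : IsBasisOf v N') (q : J → R)
    (hq : ∀ j, q j ≠ 0) (hN : N ≤ N') (hmem : ∀ j, q j • v j ∈ N)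
    (hdvd : ∀ f : J → R, ∑ j, f j • v j ∈ N → ∀ j, q j ∣ f j) :
    IsBasisOf (fun j => q j • v j) N := by
  constructor
  · rw [Fintype.linearIndependent_iff]
    intro g hg j
    simp only [smul_smul] at hg
    exact (mul_eq_zero.1 (Fintype.linearIndependent_iff.1 h.linearIndependent _ hg j)).resolve_right
      (hq j)
  · apply le_antisymm
    · rw [Submodule.span_le]
      rintro _ ⟨j, rfl⟩
      exact hmem j
    · intro θ hθ
      obtain ⟨f, rfl⟩ := h.exists_sum_eq (hN hθ)
      refine Submodule.sum_mem _ fun j _ => ?_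
      obtain ⟨g, hg⟩ := hdvd f hθ j
      rw [hg, mul_comm, mul_smul]
      exact Submodule.smul_mem _ _ (Submodule.subset_span ⟨j, rfl⟩)

end IsBasisOf

/-! ### Euler multiplicities. -/

namespace Multiarrangement

variable {K : Type u} {V : Type v} [Field K] [AddCommGroup V] [Module K V]

theorem isEulerMultiplicity_of_isBasisOf {A : Multiarrangement K V} {Y : Submodule K V}
    {α : Dual K V} {c d e : ℕ} (y : Basis (Fin c) K Y) {b : Fin 2 ⊕ Fin c → PolyDer K V}
    (hb : IsBasisOf b (A.localization Y).derivations) (hd : HasPdeg (b (Sum.inl 0)) d)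
    (he : HasPdeg (b (Sum.inl 1)) e) (hy : ∀ j, b (Sum.inr j) = directional (y j : V))
    (h0 : ¬ ∃ η : PolyDer K V, b (Sum.inl 0) = linForm α • η)
    (h1 : ∃ η : PolyDer K V, b (Sum.inl 1) = linForm α • η) :
    A.IsEulerMultiplicity (LinearMap.ker α) Y d := by
  obtain ⟨b', hb'⟩ := hb.exists_basis
  refine ⟨α, c, y, b', e, rfl, ?_, ?_, fun i β => ?_, ?_, ?_⟩
  · rwa [hb']
  · rwa [hb']
  · rw [hb', hy, directional_linForm]
  · rwa [hb']
  · rwa [hb']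

theorem localization_mult_of_le (A : Multiarrangement K V) {Y H : Submodule K V} (h : Y ≤ H) :
    (A.localization Y).mult H = A.mult H := if_pos h

theorem localization_mult_of_not_le (A : Multiarrangement K V) {Y H : Submodule K V}
    (h : ¬ Y ≤ H) : (A.localization Y).mult H = 0 := if_neg h

/-- A member of a basis of the deletion that is not affected by the addition of `ker α` is not
divisible by `α`. -/
theorem not_exists_eq_smul {B : Multiarrangement K V} {α : Dual K V} (hα : α ≠ 0) {J : Type*}
    [Fintype J] [DecidableEq J] {b : J → PolyDer K V}
    (hb : IsBasisOf b (B.deletion (LinearMap.ker α)).derivations) {i j : J} (hij : i ≠ j)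
    {q : PolyRing K V} (hmem : b i - q • b j ∈ B.derivations) :
    ¬ ∃ η : PolyDer K V, b i - q • b j = linForm α • η := by
  rintro ⟨η, hη⟩
  rw [hη] at hmem
  obtain ⟨f, rfl⟩ := hb.exists_sum_eq (mem_deletion_of_smul_mem hα hmem)
  have h0 : ∑ l, (linForm α * f l - (if l = i then 1 else 0) + if l = j then q else 0) • b l
      = 0 := by
    simp only [add_smul, sub_smul, Finset.sum_add_distrib, Finset.sum_sub_distrib, ite_smul,
      one_smul, zero_smul, Finset.sum_ite_eq', Finset.mem_univ, if_true, mul_smul,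
      ← Finset.smul_sum]
    rw [← hη]
    abel
  -- The coefficient of `b i` in this relation says that α f_i = 1, which is impossible for a prime
  -- α.
  have h1 := Fintype.linearIndependent_iff.1 hb.linearIndependent _ h0 i
  rw [if_pos rfl, if_neg hij, add_zero, sub_eq_zero] at h1
  exact (prime_linForm hα).not_isUnit (IsUnit.of_mul_eq_one _ h1)

section TwoForms

theorem exists_basis_of_dual_pair {α β : Dual K V} {w₁ w₂ : V} (h11 : α w₁ = 1) (h12 : α w₂ = 0)
    (h21 : β w₁ = 0) (h22 : β w₂ = 1) {c : ℕ}
    (y : Basis (Fin c) K (LinearMap.ker α ⊓ LinearMap.ker β : Submodule K V)) :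
    ∃ e : Basis (Fin 2 ⊕ Fin c) K V, e (Sum.inl 0) = w₂ ∧ e (Sum.inl 1) = w₁ ∧
      ∀ j, e (Sum.inr j) = y j := by
  have hyα : ∀ j, α (y j) = 0 := fun j => (y j).2.1
  have hyβ : ∀ j, β (y j) = 0 := fun j => (y j).2.2
  let f : Fin 2 ⊕ Fin c → V := Sum.elim ![w₂, w₁] fun j => (y j : V)
  have hli : LinearIndependent K f := by
    rw [Fintype.linearIndependent_iff]
    intro g hg
    simp only [f, Fintype.sum_sum_type, Fin.sum_univ_two, Sum.elim_inl, Sum.elim_inr,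
      Matrix.cons_val_zero, Matrix.cons_val_one] at hg
    have hα := congrArg α hg
    have hβ := congrArg β hg
    simp only [map_add, map_sum, map_smul, h11, h12, h21, h22, hyα, hyβ, smul_eq_mul, mul_zero,
      mul_one, Finset.sum_const_zero, add_zero, zero_add, map_zero] at hα hβ
    rw [hα, hβ, zero_smul, zero_smul, zero_add, zero_add] at hg
    have hg' : ∑ j, g (Sum.inr j) • y j = 0 := by
      apply Subtype.ext
      simpa using hg
    have := Fintype.linearIndependent_iff.1 y.linearIndependent _ hg'
    rintro (i | j)
    · fin_cases i
      · exact hβ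
      · exact hα
    · exact this j
  have hspan : ⊤ ≤ Submodule.span K (Set.range f) := by
    intro w _
    have hw : w - β w • w₂ - α w • w₁ ∈ LinearMap.ker α ⊓ LinearMap.ker β := by
      constructor <;> simp [h11, h12, h21, h22]
    have h1 := y.sum_repr ⟨_, hw⟩
    have h2 : w = β w • w₂ + α w • w₁ + ∑ j, y.repr ⟨_, hw⟩ j • (y j : V) := by
      have := congrArg Subtype.val h1
      simp only [Submodule.coe_sum, Submodule.coe_smul] at this
      rw [this]
      abel
    rw [h2]
    refine Submodule.add_mem _ (Submodule.add_mem _ (Submodule.smul_mem _ _ ?_)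
      (Submodule.smul_mem _ _ ?_)) (Submodule.sum_mem _ fun j _ => Submodule.smul_mem _ _ ?_)
    · exact Submodule.subset_span ⟨Sum.inl 0, rfl⟩
    · exact Submodule.subset_span ⟨Sum.inl 1, rfl⟩
    · exact Submodule.subset_span ⟨Sum.inr j, rfl⟩
  refine ⟨Basis.mk hli hspan, ?_, ?_, fun j => ?_⟩ <;> rw [Basis.mk_apply] <;> rfl

/-- The Euler multiplicity where only one further hyperplane `ker β` meets `ker α` in `Y`. -/
theorem isEulerMultiplicity_of_pair [FiniteDimensional K V] {A : Multiarrangement K V}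
    {α β : Dual K V} {w₁ w₂ : V}
    (h11 : α w₁ = 1) (h12 : α w₂ = 0) (h21 : β w₁ = 0) (h22 : β w₂ = 1)
    (hα : A.mult (LinearMap.ker α) ≠ 0)
    (hpair : ∀ H, A.mult H ≠ 0 → LinearMap.ker α ⊓ LinearMap.ker β ≤ H →
      H = LinearMap.ker α ∨ H = LinearMap.ker β) :
    A.IsEulerMultiplicity (LinearMap.ker α) (LinearMap.ker α ⊓ LinearMap.ker β)
      (A.mult (LinearMap.ker β)) := by
  let y := finBasis K (LinearMap.ker α ⊓ LinearMap.ker β : Submodule K V)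
  obtain ⟨e, he0, he1, hey⟩ := exists_basis_of_dual_pair h11 h12 h21 h22 y
  have hα0 : α ≠ 0 := by rintro rfl; simp at h11
  have hβ0 : β ≠ 0 := by rintro rfl; simp at h22
  set p := A.mult (LinearMap.ker α) with hp
  set q := A.mult (LinearMap.ker β) with hq
  have hD : ∀ θ : PolyDer K V,
      θ ∈ (A.localization (LinearMap.ker α ⊓ LinearMap.ker β)).derivations ↔
        linForm α ^ p ∣ θ (linForm α) ∧ linForm β ^ q ∣ θ (linForm β) := by
    intro θ
    have aux : ∀ γ : Dual K V, LinearMap.ker α ⊓ LinearMap.ker β ≤ LinearMap.ker γ →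
        θ ∈ (A.localization (LinearMap.ker α ⊓ LinearMap.ker β)).derivations →
        linForm γ ^ A.mult (LinearMap.ker γ) ∣ θ (linForm γ) := by
      intro γ hγ h
      by_cases h0 : A.mult (LinearMap.ker γ) = 0
      · rw [h0, pow_zero]; exact one_dvd _
      · rw [← localization_mult_of_le A hγ] at h0 ⊢
        exact h _ h0 γ rfl
    constructor
    · intro h
      exact ⟨aux α inf_le_left h, aux β inf_le_right h⟩
    · rintro ⟨h1, h2⟩ H hH γ hγ
      have hle : LinearMap.ker α ⊓ LinearMap.ker β ≤ H := by
        by_contra hle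
        exact hH (localization_mult_of_not_le A hle)
      have hH' : (A.localization (LinearMap.ker α ⊓ LinearMap.ker β)).mult H ≠ 0 := hH
      rw [localization_mult_of_le A hle] at hH' ⊢
      rcases hpair H hH' hle with rfl | rfl
      · exact (pow_dvd_iff_of_ker_eq hγ.symm hα0 θ _).1 h1
      · exact (pow_dvd_iff_of_ker_eq hγ.symm hβ0 θ _).1 h2
  have hey1 : ∀ j, α (e (Sum.inr j)) = 0 := fun j => by rw [hey]; exact (y j).2.1
  have hey2 : ∀ j, β (e (Sum.inr j)) = 0 := fun j => by rw [hey]; exact (y j).2.2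
  -- The localization is a product of two multiple points: in the direction dual to β the factor is
  -- β^q, in the direction dual to α it is α^p.
  let s : Fin 2 ⊕ Fin (finrank K (LinearMap.ker α ⊓ LinearMap.ker β : Submodule K V)) →
    PolyRing K V := Sum.elim ![linForm β ^ q, linForm α ^ p] fun _ => 1
  have hb : IsBasisOf (fun j => s j • (directional (e j) : PolyDer K V))
      (A.localization (LinearMap.ker α ⊓ LinearMap.ker β)).derivations := by
    refine (isBasisOf_directional e).smul s ?_ le_top ?_ ?_
    · rintro (i | j)
      · fin_cases i
        · exact pow_ne_zero _ (linForm_ne_zero hβ0)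
        · exact pow_ne_zero _ (linForm_ne_zero hα0)
      · exact one_ne_zero
    · intro j
      rw [hD, Derivation.smul_apply, Derivation.smul_apply, directional_linForm,
        directional_linForm]
      rcases j with i | j
      · fin_cases i
        · simp [s, he0, h12, h22]
        · simp [s, he1, h11, h21]
      · simp [hey1, hey2]
    · intro f hf
      rw [hD, sum_derivation_apply, sum_derivation_apply] at hf
      simp only [Derivation.smul_apply, directional_linForm, Fintype.sum_sum_type,
        Fin.sum_univ_two, he0, he1, h11, h12, h21, h22, hey1, hey2, map_zero, map_one,
        smul_eq_mul, mul_zero, mul_one, zero_add, add_zero, Finset.sum_const_zero] at hf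
      rintro (i | j)
      · fin_cases i
        · exact hf.2
        · exact hf.1
      · exact one_dvd _
  refine isEulerMultiplicity_of_isBasisOf y hb (e := p) ?_ ?_ (fun j => ?_) ?_ ?_
  · intro γ
    have := mul_mem_homogeneousPart (pow_mem_homogeneousPart (linForm_mem_homogeneousPart β) q)
      (hasPdeg_directional (e (Sum.inl 0)) γ)
    simpa [s] using this
  · intro γ
    have := mul_mem_homogeneousPart (pow_mem_homogeneousPart (linForm_mem_homogeneousPart α) p)
      (hasPdeg_directional (e (Sum.inl 1)) γ)
    simpa [s] using this
  · simp [s, hey]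
  · rintro ⟨η, hη⟩
    have h1 := congrArg (fun θ : PolyDer K V => θ (linForm β)) hη
    simp only [s, Sum.elim_inl, Matrix.cons_val_zero, Derivation.smul_apply, directional_linForm,
      he0, h22, map_one, smul_eq_mul, mul_one] at h1
    have h2 : linForm α ∣ linForm β := (prime_linForm hα0).dvd_of_dvd_pow ⟨_, h1⟩
    obtain ⟨c, hc⟩ := linForm_dvd_linForm hα0 h2
    rw [hc, LinearMap.smul_apply, h12, smul_zero] at h22
    exact zero_ne_one h22
  · obtain ⟨k, hk⟩ := Nat.exists_eq_succ_of_ne_zero hα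
    refine ⟨linForm α ^ k • directional (e (Sum.inl 1)), ?_⟩
    change linForm α ^ p • directional (e (Sum.inl 1)) = _
    rw [hk, pow_succ', mul_smul]

end TwoForms

section Triangle

variable {ι : Type*} [DecidableEq ι] {A : Multiarrangement K V} {U : Finset ι}
  {x : ι → Dual K V}

/-- An indicator function of a vertex outside U' is realized by a vector of the center of U' on
which x_a - x_b does not vanish. -/
theorem frameCenter_le_ker_iff (hx : IsFrame U x) {U' : Finset ι} (hU : U' ⊆ U) {a b : ι}
    (ha : a ∈ U) (hb : b ∈ U) (hab : a ≠ b) :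
    frameCenter U' x ≤ LinearMap.ker (x a - x b) ↔ a ∈ U' ∧ b ∈ U' := by
  constructor
  · intro h
    by_contra hcon
    have key : ∀ g : ι → K, (∀ i ∈ U', g i = 0) → g a - g b = 0 := by
      intro g hg
      obtain ⟨w, hw⟩ := hx g
      rw [← hw a ha b hb]
      refine h (mem_frameCenter.2 fun i hi j hj => ?_)
      rw [hw i (hU hi) j (hU hj), hg i hi, hg j hj, sub_zero]
    by_cases haU : a ∈ U'
    · have hbU : b ∉ U' := fun hbU => hcon ⟨haU, hbU⟩
      have := key (Pi.single b 1) fun i hi => Pi.single_eq_of_ne (by rintro rfl; exact hbU hi) _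
      simp [hab] at this
    · have := key (Pi.single a 1) fun i hi => Pi.single_eq_of_ne (by rintro rfl; exact haU hi) _
      simp [hab.symm] at this
  · rintro ⟨ha', hb'⟩ w hw
    exact mem_frameCenter.1 hw a ha' b hb'

theorem IsWeighted.localization {m : ι → ι → ℕ} (hA : A.IsWeighted U x m) (hx : IsFrame U x)
    {U' : Finset ι} (hU : U' ⊆ U) :
    (A.localization (frameCenter U' x)).IsWeighted U' x m := by
  constructor
  · intro i hi j hj hij
    rw [localization_mult_of_le A
      ((frameCenter_le_ker_iff hx hU (hU hi) (hU hj) hij).2 ⟨hi, hj⟩),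
      hA.mult_ker i (hU hi) j (hU hj) hij]
  · intro H hH
    have hle : frameCenter U' x ≤ H := by
      by_contra hle
      exact hH (localization_mult_of_not_le A hle)
    rw [localization_mult_of_le A hle] at hH
    obtain ⟨i, hi, j, hj, hij, rfl⟩ := hA.exists_of_mult_ne_zero H hH
    obtain ⟨hi', hj'⟩ := (frameCenter_le_ker_iff hx hU hi hj hij).1 hle
    exact ⟨i, hi', j, hj', hij, rfl⟩

variable {n : ι → ℕ} {G : SimpleGraph ι} {v k s : ι}

/-- The vertices of a triangle in the order `s`, `k`, `v`. -/
def triangleRank (v k a : ι) : ℕ := if a = v then 2 else if a = k then 1 else 0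

theorem triangle_elimination (hvk : v ≠ k) (hsv : s ≠ v) (hsk : s ≠ k) :
    IsPerfectElimination {v, k, s} (G.deleteEdges {s(v, k)}) (triangleRank v k) ∧
    eliminationExponents {v, k, s} n (G.deleteEdges {s(v, k)}) (triangleRank v k) =
      {n v + n k + n s + adjCount G v s, n v + n k + n s + adjCount G k s} := by
  have hrv : triangleRank v k v = 2 := if_pos rfl
  have hrk : triangleRank v k k = 1 := by simp [triangleRank, hvk.symm]
  have hrs : triangleRank v k s = 0 := by simp [triangleRank, hsv, hsk]
  constructor
  · constructor
    · intro a ha b hb hab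
      simp only [Finset.coe_insert, Finset.coe_singleton, Set.mem_insert_iff,
        Set.mem_singleton_iff] at ha hb
      rcases ha with rfl | rfl | rfl <;> rcases hb with rfl | rfl | rfl <;>
        first | rfl | (simp only [hrv, hrk, hrs] at hab; omega)
    · intro a ha u hu w hw hua hwa hau haw huw
      simp only [Finset.mem_insert, Finset.mem_singleton] at ha hu hw
      rcases ha with rfl | rfl | rfl <;> rcases hu with rfl | rfl | rfl <;>
        rcases hw with rfl | rfl | rfl <;>
        first
          | exact absurd rfl huw
          | (simp only [hrv, hrk, hrs] at hua hwa; omega)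
          | (exfalso; simp at hau; done)
          | (exfalso; simp at haw)
  · have hd : ∀ a, backDegree {v, k, s} (G.deleteEdges {s(v, k)}) (triangleRank v k) a =
        (if triangleRank v k v < triangleRank v k a then
          adjCount (G.deleteEdges {s(v, k)}) a v else 0) +
        ((if triangleRank v k k < triangleRank v k a then
          adjCount (G.deleteEdges {s(v, k)}) a k else 0) +
        (if triangleRank v k s < triangleRank v k a then
          adjCount (G.deleteEdges {s(v, k)}) a s else 0)) := by
      intro a
      rw [backDegree, Finset.card_filter, Finset.sum_insert (by simp [hvk, hsv.symm]),
        Finset.sum_insert (by simp [hsk.symm]), Finset.sum_singleton]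
      simp only [ite_and, adjCount]
    have hs1 : adjCount (G.deleteEdges {s(v, k)}) v s = adjCount G v s :=
      adjCount_deleteEdges_of_ne G (by simp [hsk, hvk])
    have hs2 : adjCount (G.deleteEdges {s(v, k)}) k s = adjCount G k s :=
      adjCount_deleteEdges_of_ne G (by simp [hsv, hvk.symm])
    have hs3 := adjCount_deleteEdges_self G v k
    have hN : ∑ i ∈ {v, k, s}, n i = n v + n k + n s := by
      rw [Finset.sum_insert (by simp [hvk, hsv.symm]), Finset.sum_insert (by simp [hsk.symm]),
        Finset.sum_singleton, add_assoc]
    -- The vertex s has back degree 0; listed first, its entry is the copy of the total weight that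
    -- is erased.
    have hU : ({v, k, s} : Finset ι).val = s ::ₘ v ::ₘ {k} := by
      rw [Finset.insert_val_of_notMem (by simp [hvk, hsv.symm]),
        Finset.insert_val_of_notMem (by simp [hsk.symm]), Finset.singleton_val]
      change v ::ₘ k ::ₘ s ::ₘ 0 = s ::ₘ v ::ₘ k ::ₘ 0
      rw [Multiset.cons_swap k s, Multiset.cons_swap v s]
    rw [eliminationExponents, hN, hU, Multiset.map_cons, Multiset.map_cons,
      Multiset.map_singleton, hd s, hd v, hd k, hrv, hrk, hrs]
    simp only [hs1, hs2, hs3]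
    simp

/-- With N = n_v + n_k + n_s, the localized deletion has the nonconstant degrees N + [vs is an edge]
and N + [ks is an edge]. The edge vk multiplies a member of the first degree by x_v - x_k, which
gives ψ; the other member gives θ and hence the Euler multiplicity. -/
theorem isEulerMultiplicity_of_triangle [CharZero K] [FiniteDimensional K V]
    (hA : A.IsWeighted U x (weight n G)) (hx : IsFrame U x) (hv : v ∈ U) (hk : k ∈ U)
    (hs : s ∈ U) (hG : G.Adj v k) (hsimp : G.Adj v s → G.Adj k s) (hsv : s ≠ v) (hsk : s ≠ k) :
    A.IsEulerMultiplicity (LinearMap.ker (x v - x k)) (frameCenter {v, k, s} x)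
      (n v + n k + n s + adjCount G k s) := by
  have hU : ({v, k, s} : Finset ι) ⊆ U := by
    intro a ha
    simp only [Finset.mem_insert, Finset.mem_singleton] at ha
    rcases ha with rfl | rfl | rfl <;> assumption
  have hx' := hx.mono hU
  have hB := hA.localization hx hU
  have hv' : v ∈ ({v, k, s} : Finset ι) := by simp
  have hk' : k ∈ ({v, k, s} : Finset ι) := by simp
  have hα := hx.sub_ne_zero hv hk hG.ne
  let y := finBasis K (frameCenter {v, k, s} x)
  obtain ⟨hel, hexp⟩ := triangle_elimination (n := n) (G := G) hG.ne hsv hsk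
  obtain ⟨l, b, d, hb, hd, hby, hE⟩ :=
    hel.hasBasisWith (n := n) hx' (hB.deletion hx' hv' hk' hG) y
  rw [hexp] at hE
  obtain ⟨i₀, hi₀, b', hb', hby', hbi₀, hbi⟩ := exists_basis_of_edge hB hx' hv' hk' hG
    (by
      intro a ha hak hva
      simp only [Finset.mem_insert, Finset.mem_singleton] at ha
      rcases ha with rfl | rfl | rfl
      · exact absurd rfl hva.ne
      · exact absurd rfl hak
      · exact hsimp hva) hb hd hby (fun j => mem_frameCenter.1 (y j).2 v hv' k hk')
  have hdeg : edgeDegree {v, k, s} n G v k = n v + n k + n s + adjCount G v s := by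
    have : (({v, k, s} : Finset ι).erase v).erase k = {s} := by
      ext a
      simp only [Finset.mem_erase, Finset.mem_insert, Finset.mem_singleton]
      constructor
      · tauto
      · rintro rfl; tauto
    rw [edgeDegree, this, Finset.sum_singleton]
    ring
  have hl : l = 2 := by
    have := congrArg Multiset.card hE
    simpa using this
  subst hl
  rw [hdeg] at hi₀
  obtain ⟨i₁, hi₁, hcover⟩ : ∃ i₁, i₁ ≠ i₀ ∧ ∃ σ : Fin 2 ≃ Fin 2, σ 0 = i₁ ∧ σ 1 = i₀ := by
    fin_cases i₀
    · exact ⟨1, by decide, Equiv.swap 0 1, by decide, by decide⟩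
    · exact ⟨0, by decide, Equiv.refl _, rfl, rfl⟩
  obtain ⟨σ, hσ0, hσ1⟩ := hcover
  have hd₁ : d i₁ = n v + n k + n s + adjCount G k s := by
    -- The two degrees may coincide, so that of the unaffected member is read off from their sum.
    have h1 := congrArg Multiset.sum hE
    have h2 : ∑ i, d i = d i₁ + d i₀ := by
      rw [← Equiv.sum_comp σ d, Fin.sum_univ_two, hσ0, hσ1]
    have h3 : (Finset.univ.val.map d).sum = ∑ i, d i := rfl
    rw [h3, h2, hi₀] at h1
    simp at h1
    omega
  obtain ⟨hpd, q, hq⟩ := hbi i₁ hi₁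
  refine isEulerMultiplicity_of_isBasisOf y (hb'.reindex (σ.sumCongr (Equiv.refl _)))
    (e := d i₀ + 1) ?_ ?_ (fun j => ?_) ?_ ?_
  · simpa [hσ0, ← hd₁] using hpd
  · simp only [Function.comp_apply, Equiv.sumCongr_apply, Sum.map_inl, hσ1, hbi₀]
    intro β
    rw [Derivation.smul_apply, smul_eq_mul, add_comm]
    exact mul_mem_homogeneousPart (linForm_mem_homogeneousPart _) (hd i₀ β)
  · simpa using hby' j
  · simp only [Function.comp_apply, Equiv.sumCongr_apply, Sum.map_inl, hσ0, hq]
    have hmem := hb'.mem (Sum.inl i₁)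
    rw [hq] at hmem
    exact not_exists_eq_smul hα hb (fun h => hi₁ (Sum.inl.inj h)) hmem
  · simp only [Function.comp_apply, Equiv.sumCongr_apply, Sum.map_inl, hσ1, hbi₀]
    exact ⟨_, rfl⟩

end Triangle

end Multiarrangement

/-! ### The restriction as a merging of vertices. -/

namespace Multiarrangement

section Restriction

variable {K : Type u} {V : Type v} [Field K] [AddCommGroup V] [Module K V]
variable {ι : Type*} {A : Multiarrangement K V} {U : Finset ι} {x : ι → Dual K V}

theorem ker_sub_comm (α β : Dual K V) : LinearMap.ker (α - β) = LinearMap.ker (β - α) := by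
  rw [← neg_sub, LinearMap.ker_neg]

/-- The restrictions of the linear forms `x i` to a subspace. -/
def restrictForms (x : ι → Dual K V) (H : Submodule K V) (i : ι) : Dual K H := x i ∘ₗ H.subtype

theorem ker_restrictForms_sub (x : ι → Dual K V) (H : Submodule K V) (i j : ι) :
    LinearMap.ker (restrictForms x H i - restrictForms x H j) =
      (LinearMap.ker (x i - x j)).comap H.subtype := by
  ext w
  simp [restrictForms]

variable [DecidableEq ι]

/-- Only the two orderings of one pair give the same hyperplane, so by symmetry of m the supremum is
taken over equal nonzero candidates. -/
theorem exists_isWeighted (hx : IsFrame U x) {m : ι → ι → ℕ} (hm : ∀ i j, m i j = m j i) :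
    ∃ A : Multiarrangement K V, A.IsWeighted U x m := by
  classical
  let f : Submodule K V → ι × ι → ℕ := fun H p =>
    if p.1 ≠ p.2 ∧ H = LinearMap.ker (x p.1 - x p.2) then m p.1 p.2 else 0
  have hf : ∀ H, (U ×ˢ U).sup (f H) ≠ 0 →
      ∃ i ∈ U, ∃ j ∈ U, i ≠ j ∧ H = LinearMap.ker (x i - x j) := by
    intro H hH
    by_contra hcon
    push Not at hcon
    apply hH
    rw [← Nat.bot_eq_zero, Finset.sup_eq_bot_iff]
    intro p hp
    rw [Finset.mem_product] at hp
    exact if_neg fun h => hcon p.1 hp.1 p.2 hp.2 h.1 h.2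
  refine ⟨⟨fun H => (U ×ˢ U).sup (f H), ?_, ?_⟩, ?_, hf⟩
  · refine (((U ×ˢ U).image fun p => LinearMap.ker (x p.1 - x p.2)).finite_toSet).subset ?_
    intro H hH
    obtain ⟨i, hi, j, hj, -, rfl⟩ := hf H hH
    exact Finset.mem_coe.2 (Finset.mem_image.2 ⟨(i, j), Finset.mem_product.2 ⟨hi, hj⟩, rfl⟩)
  · intro H hH
    obtain ⟨i, hi, j, hj, hij, rfl⟩ := hf H hH
    exact LinearMap.isCoatom_ker_of_surjective (LinearMap.surjective (hx.sub_ne_zero hi hj hij))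
  · intro i hi j hj hij
    apply le_antisymm
    · refine Finset.sup_le fun p hp => ?_
      rw [Finset.mem_product] at hp
      simp only [f]
      split_ifs with h
      · rcases hx.eq_or_eq_of_ker_eq hp.1 hp.2 hi hj h.1 hij h.2 with ⟨h1, h2⟩ | ⟨h1, h2⟩
        · rw [h1, h2]
        · rw [h1, h2, hm]
      · exact Nat.zero_le _
    · have : f (LinearMap.ker (x i - x j)) (i, j) = m i j := if_pos ⟨hij, rfl⟩
      rw [← this]
      exact Finset.le_sup (f := f (LinearMap.ker (x i - x j))) (Finset.mem_product.2 ⟨hi, hj⟩)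

variable {n : ι → ℕ} {G : SimpleGraph ι} {v k : ι}

/-- Values on U without v extend to U by giving v the value at k; the resulting vector lies in the
hyperplane. -/
theorem isFrame_restrictForms (hx : IsFrame U x) (hv : v ∈ U) (hk : k ∈ U) (hvk : v ≠ k) :
    IsFrame (U.erase v) (restrictForms x (LinearMap.ker (x v - x k))) := by
  intro g
  obtain ⟨w, hw⟩ := hx (Function.update g v (g k))
  have hw0 : w ∈ LinearMap.ker (x v - x k) := by
    rw [LinearMap.mem_ker, hw v hv k hk]
    simp [hvk.symm]
  refine ⟨⟨w, hw0⟩, fun i hi j hj => ?_⟩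
  have := hw i (Finset.mem_of_mem_erase hi) j (Finset.mem_of_mem_erase hj)
  rwa [Function.update_of_ne (Finset.ne_of_mem_erase hi),
    Function.update_of_ne (Finset.ne_of_mem_erase hj)] at this

/-- The vertex that represents `a` after `v` has been merged with `k`. -/
def mergeVertex (v k a : ι) : ι := if a = v then k else a

theorem restrictForms_mergeVertex (x : ι → Dual K V) (v k a : ι) :
    restrictForms x (LinearMap.ker (x v - x k)) (mergeVertex v k a) =
      restrictForms x (LinearMap.ker (x v - x k)) a := by
  unfold mergeVertex
  split_ifs with h
  · subst h
    ext w
    exact (sub_eq_zero.1 w.2).symm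
  · rfl

theorem mergeVertex_mem (hk : k ∈ U) (hvk : v ≠ k) {a : ι} (ha : a ∈ U) :
    mergeVertex v k a ∈ U.erase v := by
  unfold mergeVertex
  split_ifs with h
  · exact Finset.mem_erase.2 ⟨hvk.symm, hk⟩
  · exact Finset.mem_erase.2 ⟨h, ha⟩

theorem weight_merge_self {j : ι} (hjk : j ≠ k) :
    weight (Function.update n k (n k + n v)) G k j = n v + n k + n j + adjCount G k j := by
  rw [weight, Function.update_self, Function.update_of_ne hjk, add_comm (n k)]

theorem weight_merge_of_ne {i j : ι} (hik : i ≠ k) (hjk : j ≠ k) :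
    weight (Function.update n k (n k + n v)) G i j = weight n G i j := by
  rw [weight, weight, Function.update_of_ne hik, Function.update_of_ne hjk]

/-- This shows that no hyperplane other than x_v = x_k is lost in the restriction. The clique
condition covers edges at v, which become edges at k. -/
theorem weight_le_weight_merge (hvk : v ≠ k) (hsimp : ∀ s ∈ U, s ≠ k → G.Adj v s → G.Adj k s)
    {a b : ι} (ha : a ∈ U) (hb : b ∈ U) (hab : a ≠ b) (hne : s(a, b) ≠ s(v, k)) :
    mergeVertex v k a ≠ mergeVertex v k b ∧
    weight n G a b ≤ weight (Function.update n k (n k + n v)) G (mergeVertex v k a)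
      (mergeVertex v k b) := by
  wlog hbv : b ≠ v generalizing a b
  · have hav : a ≠ v := by
      rintro rfl
      exact hab (not_not.1 hbv).symm
    have := this hb ha hab.symm (by rwa [Sym2.eq_swap]) hav
    rw [weight_comm n G a b, weight_comm _ G (mergeVertex v k a)]
    exact ⟨this.1.symm, this.2⟩
  have hb' : mergeVertex v k b = b := if_neg hbv
  rw [hb']
  by_cases hav : a = v
  · subst hav
    have ha' : mergeVertex a k a = k := if_pos rfl
    have hbk : b ≠ k := by
      rintro rfl
      exact hne rfl
    rw [ha', weight_merge_self hbk, weight]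
    have := adjCount_mono (hsimp b hb hbk)
    exact ⟨hbk.symm, by omega⟩
  · have ha' : mergeVertex v k a = a := if_neg hav
    rw [ha']
    refine ⟨hab, ?_⟩
    have hle : ∀ i, n i ≤ Function.update n k (n k + n v) i := by
      intro i
      by_cases hi : i = k
      · subst hi; rw [Function.update_self]; omega
      · rw [Function.update_of_ne hi]
    have h1 := hle a
    have h2 := hle b
    rw [weight, weight]
    omega

theorem exists_hyperplane_of_weight_merge_ne_zero (hA : A.IsWeighted U x (weight n G))
    (hx : IsFrame U x) (hv : v ∈ U) (hk : k ∈ U) (hvk : v ≠ k) {i j : ι} (hi : i ∈ U.erase v)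
    (hj : j ∈ U.erase v) (hij : i ≠ j)
    (h0 : weight (Function.update n k (n k + n v)) G i j ≠ 0) :
    ∃ H ∈ A.hyperplanes, H ≠ LinearMap.ker (x v - x k) ∧
      LinearMap.ker (restrictForms x (LinearMap.ker (x v - x k)) i -
        restrictForms x (LinearMap.ker (x v - x k)) j) =
      H.comap (LinearMap.ker (x v - x k)).subtype := by
  wlog hjk : j ≠ k generalizing i j
  · have hik : i ≠ k := by
      rintro rfl
      exact hij (not_not.1 hjk).symm
    obtain ⟨H, hH, hne, hker⟩ := this hj hi hij.symm (by rwa [weight_comm]) hik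
    exact ⟨H, hH, hne, (ker_sub_comm _ _).trans hker⟩
  obtain ⟨hiv, hiU⟩ := Finset.mem_erase.1 hi
  obtain ⟨hjv, hjU⟩ := Finset.mem_erase.1 hj
  by_cases hw : weight n G i j = 0
  · have hik : i = k := by
      by_contra hik
      rw [weight_merge_of_ne hik hjk] at h0
      exact h0 hw
    subst hik
    rw [weight_merge_self hjk] at h0
    rw [weight] at hw
    refine ⟨LinearMap.ker (x v - x j), ?_, ?_, ?_⟩
    · change A.mult _ ≠ 0
      rw [hA.mult_ker v hv j hjU hjv.symm, weight]
      omega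
    · intro h
      rcases hx.eq_or_eq_of_ker_eq hv hk hv hjU hvk hjv.symm h with h | h
      · exact hjk h.2
      · exact hvk h.1
    · rw [← ker_restrictForms_sub, ← restrictForms_mergeVertex x v i v]
      simp [mergeVertex]
  · refine ⟨LinearMap.ker (x i - x j), ?_, ?_, ker_restrictForms_sub _ _ _ _⟩
    · change A.mult _ ≠ 0
      rwa [hA.mult_ker i hiU j hjU hij]
    · intro h
      rcases hx.eq_or_eq_of_ker_eq hv hk hiU hjU hvk hij h with h | h
      · exact hiv h.1
      · exact hjv h.2

theorem eq_of_inf_le_ker (hx : IsFrame U x) {i j a b : ι} (hv : v ∈ U) (hk : k ∈ U) (hi : i ∈ U)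
    (hj : j ∈ U) (ha : a ∈ U) (hb : b ∈ U) (hab : a ≠ b) (hiv : i ≠ v) (hjv : j ≠ v)
    (hik : i ≠ k) (hjk : j ≠ k)
    (h : LinearMap.ker (x v - x k) ⊓ LinearMap.ker (x i - x j) ≤ LinearMap.ker (x a - x b)) :
    LinearMap.ker (x a - x b) = LinearMap.ker (x v - x k) ∨
      LinearMap.ker (x a - x b) = LinearMap.ker (x i - x j) := by
  have key : ∀ g : ι → K, g v = g k → g i = g j → g a = g b := by
    intro g h1 h2
    obtain ⟨w, hw⟩ := hx g
    have : w ∈ LinearMap.ker (x a - x b) := h ⟨by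
      rw [SetLike.mem_coe, LinearMap.mem_ker, hw v hv k hk, h1, sub_self], by
      rw [SetLike.mem_coe, LinearMap.mem_ker, hw i hi j hj, h2, sub_self]⟩
    rw [LinearMap.mem_ker, hw a ha b hb] at this
    exact sub_eq_zero.1 this
  -- The indicator functions of {v, k} and {i, j} show that neither pair separates a from b; that of
  -- a alone excludes an a outside both pairs.
  have h1 := key (fun c => if c = v ∨ c = k then 1 else 0) (by simp)
    (by simp [hiv, hjv, hik, hjk])
  have h2 := key (fun c => if c = i ∨ c = j then 1 else 0)
    (by simp [hiv.symm, hjv.symm, hik.symm, hjk.symm]) (by simp)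
  by_cases hav : a = v ∨ a = k
  · have hbv : b = v ∨ b = k := by
      by_contra hbv
      simp [hav, hbv] at h1
    left
    rcases hav with rfl | rfl <;> rcases hbv with rfl | rfl
    · exact absurd rfl hab
    · rfl
    · exact ker_sub_comm _ _
    · exact absurd rfl hab
  by_cases hai : a = i ∨ a = j
  · have hbi : b = i ∨ b = j := by
      by_contra hbi
      simp [hai, hbi] at h2
    right
    rcases hai with rfl | rfl <;> rcases hbi with rfl | rfl
    · exact absurd rfl hab
    · rfl
    · exact ker_sub_comm _ _
    · exact absurd rfl hab
  push Not at hav hai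
  have h3 := key (Pi.single a 1) (by simp [hav.1.symm, hav.2.symm])
    (by simp [hai.1.symm, hai.2.symm])
  simp [hab.symm] at h3

/-- If one of i, j is k, the localization is that of a triangle. Otherwise the pairs vk and ij are
disjoint, only two hyperplanes can contain the intersection, and the multiplicity is inherited. -/
theorem isEulerMultiplicity_merge [CharZero K] [FiniteDimensional K V]
    (hA : A.IsWeighted U x (weight n G)) (hx : IsFrame U x) (hv : v ∈ U) (hk : k ∈ U)
    (hG : G.Adj v k) (hsimp : ∀ s ∈ U, s ≠ k → G.Adj v s → G.Adj k s) {i j : ι}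
    (hi : i ∈ U.erase v) (hj : j ∈ U.erase v) (hij : i ≠ j) :
    A.IsEulerMultiplicity (LinearMap.ker (x v - x k))
      (LinearMap.ker (x v - x k) ⊓ LinearMap.ker (x i - x j))
      (weight (Function.update n k (n k + n v)) G i j) := by
  wlog hjk : j ≠ k generalizing i j
  · have hik : i ≠ k := by
      rintro rfl
      exact hij (not_not.1 hjk).symm
    have := this hj hi hij.symm hik
    rwa [weight_comm, ker_sub_comm (x i)]
  obtain ⟨hiv, hiU⟩ := Finset.mem_erase.1 hi
  obtain ⟨hjv, hjU⟩ := Finset.mem_erase.1 hj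
  by_cases hik : i = k
  · subst hik
    have hY : LinearMap.ker (x v - x i) ⊓ LinearMap.ker (x i - x j) = frameCenter {v, i, j} x := by
      ext w
      rw [mem_frameCenter]
      constructor
      · rintro ⟨h1, h2⟩
        have h1 : x v w = x i w := sub_eq_zero.1 h1
        have h2 : x i w = x j w := sub_eq_zero.1 h2
        intro a ha b hb
        simp only [Finset.mem_insert, Finset.mem_singleton] at ha hb
        rw [LinearMap.sub_apply]
        rcases ha with rfl | rfl | rfl <;> rcases hb with rfl | rfl | rfl <;> simp [h1, h2]
      · intro h
        exact ⟨h v (by simp) i (by simp), h i (by simp) j (by simp)⟩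
    rw [hY, weight_merge_self hjk]
    exact isEulerMultiplicity_of_triangle hA hx hv hk hjU hG (hsimp j hjU hjk) hjv hjk
  · obtain ⟨w₁, hw₁⟩ := hx (Pi.single v 1)
    obtain ⟨w₂, hw₂⟩ := hx (Pi.single i 1)
    have hm : weight (Function.update n k (n k + n v)) G i j =
        A.mult (LinearMap.ker (x i - x j)) := by
      rw [weight_merge_of_ne hik hjk, hA.mult_ker i hiU j hjU hij]
    rw [hm]
    refine isEulerMultiplicity_of_pair (w₁ := w₁) (w₂ := w₂) ?_ ?_ ?_ ?_ ?_ ?_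
    · rw [hw₁ v hv k hk]; simp [hG.ne.symm]
    · rw [hw₂ v hv k hk]; simp [hiv.symm, Ne.symm hik]
    · rw [hw₁ i hiU j hjU]; simp [hiv, hjv]
    · rw [hw₂ i hiU j hjU]; simp [hij.symm]
    · rw [hA.mult_ker v hv k hk hG.ne, weight, adjCount_of_adj hG]; omega
    · intro H hH hle
      obtain ⟨a, ha, b, hb, hab, rfl⟩ := hA.exists_of_mult_ne_zero H hH
      exact eq_of_inf_le_ker hx hv hk hiU hjU ha hb hab hiv hjv hik hjk hle

/-- The restriction to `x v = x k` of a braid-like multiarrangement: the vertex `v` is merged with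
its neighbour `k`. -/
theorem IsWeighted.isRestriction [CharZero K] [FiniteDimensional K V]
    (hA : A.IsWeighted U x (weight n G)) (hx : IsFrame U x) (hv : v ∈ U) (hk : k ∈ U)
    (hG : G.Adj v k) (hsimp : ∀ s ∈ U, s ≠ k → G.Adj v s → G.Adj k s)
    {R : Multiarrangement K (LinearMap.ker (x v - x k))}
    (hR : R.IsWeighted (U.erase v) (restrictForms x (LinearMap.ker (x v - x k)))
      (weight (Function.update n k (n k + n v)) G)) :
    A.IsRestriction (LinearMap.ker (x v - x k)) R := by
  constructor
  · ext Y
    constructor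
    · intro hY
      obtain ⟨i, hi, j, hj, hij, rfl⟩ := hR.exists_of_mult_ne_zero Y hY
      have hY' : R.mult _ ≠ 0 := hY
      rw [hR.mult_ker i hi j hj hij] at hY'
      exact exists_hyperplane_of_weight_merge_ne_zero hA hx hv hk hG.ne hi hj hij hY'
    · rintro ⟨H, hH, hne, rfl⟩
      obtain ⟨a, ha, b, hb, hab, rfl⟩ := hA.exists_of_mult_ne_zero H hH
      have hH' : A.mult _ ≠ 0 := hH
      rw [hA.mult_ker a ha b hb hab] at hH'
      have hs : s(a, b) ≠ s(v, k) := by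
        intro hs
        apply hne
        rcases Sym2.eq_iff.1 hs with ⟨rfl, rfl⟩ | ⟨rfl, rfl⟩
        · rfl
        · exact ker_sub_comm _ _
      obtain ⟨h1, h2⟩ := weight_le_weight_merge (n := n) hG.ne hsimp ha hb hab hs
      change R.mult _ ≠ 0
      rw [← ker_restrictForms_sub, ← restrictForms_mergeVertex x v k a,
        ← restrictForms_mergeVertex x v k b,
        hR.mult_ker _ (mergeVertex_mem hk hG.ne ha) _ (mergeVertex_mem hk hG.ne hb) h1]
      omega
  · intro Y hY
    obtain ⟨i, hi, j, hj, hij, rfl⟩ := hR.exists_of_mult_ne_zero Y hY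
    rw [hR.mult_ker i hi j hj hij, ker_restrictForms_sub, Submodule.map_comap_subtype]
    exact isEulerMultiplicity_merge hA hx hv hk hG hsimp hi hj hij

/-- Both |U| and the dimension of the space drop by one. Consequently deletion and restriction carry
equally many zeros for the constant derivations. -/
theorem finrank_frameCenter_restrictForms [FiniteDimensional K V] (hx : IsFrame U x)
    (hv : v ∈ U) (hk : k ∈ U) (hvk : v ≠ k) :
    finrank K (frameCenter (U.erase v) (restrictForms x (LinearMap.ker (x v - x k)))) =
      finrank K (frameCenter U x) := by
  have h1 := finrank_eq_add_finrank_frameCenter hx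
  have h2 := finrank_eq_add_finrank_frameCenter (isFrame_restrictForms hx hv hk hvk)
  have h3 := Dual.finrank_ker_add_one_of_ne_zero (hx.sub_ne_zero hv hk hvk)
  have h4 : 2 ≤ U.card := by
    rw [← Finset.card_pair hvk]
    exact Finset.card_le_card (by
      intro a ha
      simp only [Finset.mem_insert, Finset.mem_singleton] at ha
      rcases ha with rfl | rfl <;> assumption)
  rw [Finset.card_erase_of_mem hv] at h2
  omega

end Restriction

/-- Inductive freeness of the braid-like multiarrangements of perfect elimination graphs. -/
theorem IsPerfectElimination.inductivelyFree {K : Type u} [Field K] [CharZero K] {ι : Type*}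
    [DecidableEq ι] {U : Finset ι} {n : ι → ℕ} {G : SimpleGraph ι} {r : ι → ℕ}
    (h : IsPerfectElimination U G r) {V : Type v} [AddCommGroup V] [Module K V]
    [FiniteDimensional K V] {A : Multiarrangement K V} {x : ι → Dual K V} (hx : IsFrame U x)
    (hA : A.IsWeighted U x (weight n G)) : InductivelyFree K V A := by
  -- The space and the frame are quantified inside the motive because the restriction lives in the
  -- hyperplane. The basis is carried along to supply the exponents for the addition step.
  refine (h.induction (motive := fun U n G E => ∀ (V : Type v) [AddCommGroup V] [Module K V]
    [FiniteDimensional K V] (A : Multiarrangement K V) (x : ι → Dual K V), IsFrame U x →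
    A.IsWeighted U x (weight n G) → InductivelyFree K V A ∧
    A.HasBasisWith (fun j => (finBasis K (frameCenter U x) j : V)) E)
    ?_ ?_ ?_ U n G r V A x hx hA).1
  · intro U n G hn hG V _ _ _ A x hx hA
    rw [hA.eq_empty fun i hi j hj _ => by
      rw [weight, hn i hi, hn j hj, adjCount_of_not_adj (hG i hi j hj)]]
    exact ⟨.empty V, hasBasisWith_empty hx _⟩
  · intro U n G i E hi hni hG ih V _ _ _ A x hx hA
    exact ih V A x hx (hA.congr fun a ha b hb hab => weight_shift hni hG ha hb hab)
  · intro U n G v k T hv hk hvk hsimp ih ih' V _ _ _ A x hx hA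
    obtain ⟨h1, h2⟩ := ih V _ x hx (hA.deletion hx hv hk hvk)
    have hx' := isFrame_restrictForms hx hv hk hvk.ne
    obtain ⟨R, hR⟩ := exists_isWeighted hx'
      (m := weight (Function.update n k (n k + n v)) G) (weight_comm _ _)
    obtain ⟨h3, h4⟩ := ih' _ R _ hx' hR
    refine ⟨?_, HasBasisWith.of_edge hA hx hv hk hvk hsimp
      (fun j => mem_frameCenter.1 (finBasis K (frameCenter U x) j).2 v hv k hk) h2⟩
    refine .addition V A _ ?_ R (hA.isRestriction hx hv hk hvk hsimp hR) h1 h3 _ _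
      h2.hasExponents h4.hasExponents ?_
    · change A.mult _ ≠ 0
      rw [hA.mult_ker v hv k hk hvk.ne, weight, adjCount_of_adj hvk]
      omega
    · rw [finrank_frameCenter_restrictForms hx hv hk hvk.ne]
      -- The nonzero-rank parts of the exponents are T for the restriction and d, T for the
      -- deletion.
      exact add_le_add (Multiset.le_cons_self _ _) le_rfl

end Multiarrangement

/-! ### Constant multiplicities: the empty and the complete graph. -/

namespace Multiarrangement

theorem isWeighted_ofForms {K : Type u} {V : Type v} [Field K] [AddCommGroup V] [Module K V]
    {ℓ : ℕ} (x : Fin ℓ → Dual K V) (α : BraidIndex ℓ → Dual K V) (hα : ∀ p, α p ≠ 0)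
    (h : ∀ p, α p = x p.1.1 - x p.1.2) (m : ℕ) :
    (ofForms α hα m).IsWeighted Finset.univ x fun _ _ => m := by
  constructor
  · intro i _ j _ hij
    refine if_pos ?_
    rcases lt_or_gt_of_ne hij with hlt | hlt
    · exact ⟨⟨(i, j), hlt⟩, congrArg LinearMap.ker (h _)⟩
    · exact ⟨⟨(j, i), hlt⟩, (congrArg LinearMap.ker (h _)).trans (ker_sub_comm _ _)⟩
  · intro H hH
    have hmem : H ∈ Set.range fun p => LinearMap.ker (α p) := by
      by_contra hcon
      exact hH (if_neg hcon)
    obtain ⟨p, rfl⟩ := hmem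
    exact ⟨p.1.1, Finset.mem_univ _, p.1.2, Finset.mem_univ _, p.2.ne, by
      beta_reduce; rw [h]⟩

theorem isPerfectElimination_bot (ℓ : ℕ) :
    IsPerfectElimination (Finset.univ : Finset (Fin ℓ)) ⊥ Fin.val :=
  ⟨Fin.val_injective.injOn, fun _ _ _ _ _ _ _ _ h => absurd h (by simp)⟩

theorem isPerfectElimination_top (ℓ : ℕ) :
    IsPerfectElimination (Finset.univ : Finset (Fin ℓ)) ⊤ Fin.val :=
  ⟨Fin.val_injective.injOn, fun _ _ _ _ _ _ _ _ _ _ h => h⟩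

theorem weight_bot {ι : Type*} (k : ℕ) (i j : ι) : weight (fun _ => k) ⊥ i j = k + k := by
  rw [weight, adjCount_of_not_adj (by simp), add_zero]

theorem weight_top {ι : Type*} (k : ℕ) {i j : ι} (hij : i ≠ j) :
    weight (fun _ => k) ⊤ i j = 2 * k + 1 := by
  rw [weight, adjCount_of_adj (by simpa using hij)]
  ring

theorem eliminationExponents_bot (ℓ k : ℕ) :
    eliminationExponents (Finset.univ : Finset (Fin ℓ)) (fun _ => k) ⊥ Fin.val =
      Multiset.replicate (ℓ - 1) (ℓ * k) := by
  rw [eliminationExponents_of_no_edges (by simp)]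
  simp

theorem backDegree_top {ℓ : ℕ} (v : Fin ℓ) :
    backDegree (Finset.univ : Finset (Fin ℓ)) ⊤ Fin.val v = v := by
  refine Eq.trans ?_ (Fin.card_Iio v)
  rw [backDegree]
  congr 1
  ext u
  simp only [Finset.mem_filter, Finset.mem_univ, true_and, SimpleGraph.top_adj, Finset.mem_Iio,
    Fin.lt_def]
  constructor
  · exact fun h => h.1
  · intro h
    exact ⟨h, by rintro rfl; omega⟩

theorem eliminationExponents_top (ℓ k : ℕ) :
    eliminationExponents (Finset.univ : Finset (Fin ℓ)) (fun _ => k) ⊤ Fin.val =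
      (Multiset.Icc 1 (ℓ - 1)).map fun j => ℓ * k + j := by
  have h1 : ∑ i : Fin ℓ, k = ℓ * k := by simp
  rw [eliminationExponents, h1]
  simp only [backDegree_top]
  cases ℓ with
  | zero => rfl
  | succ l =>
    have h2 : (Finset.univ : Finset (Fin (l + 1))).val.map Fin.val = 0 ::ₘ Multiset.Icc 1 l := by
      have h3 : (Finset.univ : Finset (Fin (l + 1))).map Fin.valEmbedding =
          insert 0 (Finset.Icc 1 l) := by
        ext a
        simp only [Finset.mem_map, Finset.mem_univ, true_and, Fin.valEmbedding_apply,
          Finset.mem_insert, Finset.mem_Icc]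
        constructor
        · rintro ⟨i, rfl⟩
          omega
        · intro ha
          exact ⟨⟨a, by omega⟩, rfl⟩
      have h4 := congrArg Finset.val h3
      rwa [Finset.map_val, Finset.insert_val_of_notMem (by simp)] at h4
    have h5 : (Finset.univ : Finset (Fin (l + 1))).val.map
        (fun v : Fin (l + 1) => (l + 1) * k + (v : ℕ)) =
        ((Finset.univ : Finset (Fin (l + 1))).val.map Fin.val).map fun j => (l + 1) * k + j := by
      rw [Multiset.map_map]
      rfl
    rw [h5, h2, Multiset.map_cons, add_zero, Multiset.erase_cons_head, Nat.add_sub_cancel]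

/-- With a trivial center there are no extra zeros from constant derivations. -/
theorem IsPerfectElimination.hasExponents {K : Type u} [Field K] [CharZero K] {V : Type v}
    [AddCommGroup V] [Module K V] [FiniteDimensional K V] {ι : Type*} [DecidableEq ι]
    {U : Finset ι} {n : ι → ℕ} {G : SimpleGraph ι} {r : ι → ℕ} (h : IsPerfectElimination U G r)
    {A : Multiarrangement K V} {x : ι → Dual K V} (hx : IsFrame U x)
    (hA : A.IsWeighted U x (weight n G)) (hc : frameCenter U x = ⊥) :
    A.HasExponents (eliminationExponents U n G r) := by
  have hb := (h.hasBasisWith hx hA (finBasis K (frameCenter U x))).hasExponents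
  have h0 : finrank K (frameCenter U x) = 0 := by rw [hc, finrank_bot]
  rwa [h0, Multiset.replicate_zero, add_zero] at hb

theorem inductivelyFree_of_isWeighted_const {K : Type u} [Field K] [CharZero K] {V : Type v}
    [AddCommGroup V] [Module K V] [FiniteDimensional K V] {A : Multiarrangement K V} {ℓ m : ℕ}
    {x : Fin ℓ → Dual K V} (hx : IsFrame Finset.univ x)
    (hA : A.IsWeighted Finset.univ x fun _ _ => m) : InductivelyFree K V A := by
  rcases Nat.even_or_odd m with ⟨k, rfl⟩ | ⟨k, rfl⟩
  · exact (isPerfectElimination_bot ℓ).inductivelyFree hx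
      (hA.congr fun i _ j _ _ => (weight_bot k i j).symm)
  · exact (isPerfectElimination_top ℓ).inductivelyFree hx
      (hA.congr fun i _ j _ hij => (weight_top k hij).symm)

end Multiarrangement

/-! ### The braid arrangement and the Coxeter arrangement of type A. -/

open Multiarrangement

theorem isFrame_coordForm (ℓ : ℕ) : IsFrame Finset.univ (coordForm ℓ) := fun g =>
  ⟨g, fun _ _ _ _ => rfl⟩

theorem isFrame_coordForm_sumZero (ℓ : ℕ) :
    IsFrame Finset.univ (restrictForms (coordForm ℓ) (sumZero ℓ)) := by
  intro g
  -- Subtracting the mean moves a vector into the hyperplane of sum zero without changing the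
  -- differences of its coordinates.
  have hmem : (fun i => g i - (∑ j, g j) / ℓ) ∈ sumZero ℓ := by
    rcases Nat.eq_zero_or_pos ℓ with rfl | hℓ
    · simp [sumZero]
    · have : (ℓ : ℂ) ≠ 0 := Nat.cast_ne_zero.2 hℓ.ne'
      simp [sumZero, coordForm, LinearMap.sum_apply, Finset.sum_sub_distrib]
      field_simp
      simp
  refine ⟨⟨_, hmem⟩, fun i _ j _ => ?_⟩
  simp [restrictForms, coordForm]

theorem frameCenter_coordForm_sumZero (ℓ : ℕ) :
    frameCenter Finset.univ (restrictForms (coordForm ℓ) (sumZero ℓ)) = ⊥ := by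
  rw [eq_bot_iff]
  rintro ⟨w, hw⟩ hmem
  rw [mem_frameCenter] at hmem
  have hconst : ∀ i j, w i = w j := fun i j =>
    sub_eq_zero.1 (hmem i (Finset.mem_univ _) j (Finset.mem_univ _))
  have hsum : ∑ i, w i = 0 := by
    simpa [sumZero, coordForm, LinearMap.sum_apply] using hw
  rw [Submodule.mem_bot]
  apply Subtype.ext
  funext i
  have h1 : ∑ j, w j = ℓ * w i := by
    rw [Finset.sum_congr rfl fun j _ => hconst j i]
    simp
  have hℓ : (ℓ : ℂ) ≠ 0 := Nat.cast_ne_zero.2 (Fin.pos i).ne'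
  rw [hsum] at h1
  exact (mul_eq_zero.1 h1.symm).resolve_left hℓ

theorem isWeighted_braidMulti (ℓ m : ℕ) :
    (braidMulti ℓ m).IsWeighted Finset.univ (coordForm ℓ) fun _ _ => m :=
  isWeighted_ofForms _ _ _ (fun _ => rfl) m

theorem isWeighted_coxeterAMulti (ℓ m : ℕ) :
    (coxeterAMulti ℓ m).IsWeighted Finset.univ (restrictForms (coordForm ℓ) (sumZero ℓ))
      fun _ _ => m :=
  isWeighted_ofForms _ (coxeterForm ℓ) (coxeterForm_ne_zero ℓ)
    (fun _ => LinearMap.ext fun _ => rfl) m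

theorem hasExponents_coxeterAMulti {ℓ m : ℕ} {n : Fin ℓ → ℕ} {G : SimpleGraph (Fin ℓ)}
    {r : Fin ℓ → ℕ} (h : IsPerfectElimination Finset.univ G r)
    (hm : ∀ i j, i ≠ j → weight n G i j = m) :
    (coxeterAMulti ℓ m).HasExponents (eliminationExponents Finset.univ n G r) := by
  exact h.hasExponents (isFrame_coordForm_sumZero ℓ)
    ((isWeighted_coxeterAMulti ℓ m).congr fun i _ j _ hij => (hm i j hij).symm)
    (frameCenter_coordForm_sumZero ℓ)

theorem ker_braidForm_injective (ℓ : ℕ) :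
    Function.Injective fun p : BraidIndex ℓ => LinearMap.ker (braidForm ℓ p) := by
  rintro ⟨⟨i, j⟩, hij⟩ ⟨⟨a, b⟩, hab⟩ h
  rcases (isFrame_coordForm ℓ).eq_or_eq_of_ker_eq (Finset.mem_univ a) (Finset.mem_univ b)
    (Finset.mem_univ i) (Finset.mem_univ j) (ne_of_lt hab) (ne_of_lt hij) h with h | h
  · obtain ⟨rfl, rfl⟩ := h
    rfl
  · obtain ⟨rfl, rfl⟩ := h
    exact absurd hij (lt_asymm hab)

theorem isDefiningPolynomial_braidMulti (ℓ m : ℕ) (hm : 1 ≤ m) :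
    (braidMulti ℓ m).IsDefiningPolynomial
      (∏ i : Fin ℓ, ∏ j ∈ Finset.Ioi i,
        (linForm (coordForm ℓ i) - linForm (coordForm ℓ j)) ^ m) := by
  classical
  -- Each hyperplane of the arrangement is the kernel of x_i - x_j for a unique i < j, so the form
  -- can be chosen with this sign; the value 0 elsewhere plays no role.
  let α : Submodule ℂ (Fin ℓ → ℂ) → Dual ℂ (Fin ℓ → ℂ) :=
    Function.extend (fun p : BraidIndex ℓ => LinearMap.ker (braidForm ℓ p)) (braidForm ℓ) 0
  have hα : ∀ p, α (LinearMap.ker (braidForm ℓ p)) = braidForm ℓ p := fun p =>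
    (ker_braidForm_injective ℓ).extend_apply _ _ p
  have hmult : ∀ p, (braidMulti ℓ m).mult (LinearMap.ker (braidForm ℓ p)) = m := fun p =>
    if_pos ⟨p, rfl⟩
  have hmem : ∀ H, (braidMulti ℓ m).mult H ≠ 0 → ∃ p, LinearMap.ker (braidForm ℓ p) = H := by
    intro H hH
    by_contra hcon
    exact hH (if_neg hcon)
  refine ⟨α, fun H hH => ?_, ?_⟩
  · obtain ⟨p, rfl⟩ := hmem H hH
    rw [hα]
  · have hsupp : (braidMulti ℓ m).finite_support.toFinset =
        Finset.univ.image fun p : BraidIndex ℓ => LinearMap.ker (braidForm ℓ p) := by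
      ext H
      rw [Set.Finite.mem_toFinset, Function.mem_support, Finset.mem_image]
      constructor
      · intro hH
        obtain ⟨p, hp⟩ := hmem H hH
        exact ⟨p, Finset.mem_univ _, hp⟩
      · rintro ⟨p, -, rfl⟩
        rw [hmult]
        omega
    rw [hsupp, Finset.prod_image (ker_braidForm_injective ℓ).injOn]
    simp only [hα, hmult]
    rw [← Finset.prod_finset_product
        ((Finset.univ : Finset (Fin ℓ × Fin ℓ)).filter fun p => p.1 < p.2)
        Finset.univ (fun i => Finset.Ioi i) (by simp)
        (f := fun p => (linForm (coordForm ℓ p.1) - linForm (coordForm ℓ p.2)) ^ m),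
      Finset.prod_subtype (p := fun p : Fin ℓ × Fin ℓ => p.1 < p.2) _ (by simp)]
    refine Finset.prod_congr rfl fun p _ => ?_
    rw [braidForm, linForm_sub]

theorem theorem1p1 (ℓ m : ℕ) (hm : 1 ≤ m) :
    (braidMulti ℓ m).IsDefiningPolynomial
      (∏ i : Fin ℓ, ∏ j ∈ Finset.Ioi i,
        (linForm (coordForm ℓ i) - linForm (coordForm ℓ j)) ^ m) ∧
    Multiarrangement.InductivelyFree ℂ (Fin ℓ → ℂ) (braidMulti ℓ m) ∧
    Multiarrangement.InductivelyFree ℂ (sumZero ℓ) (coxeterAMulti ℓ m) ∧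
    (Even m → (coxeterAMulti ℓ m).HasExponents (Multiset.replicate (ℓ - 1) (m * ℓ / 2))) ∧
    (Odd m → (coxeterAMulti ℓ m).HasExponents
      ((Multiset.Icc 1 (ℓ - 1)).map fun k => (m - 1) * ℓ / 2 + k)) := by
  refine ⟨isDefiningPolynomial_braidMulti ℓ m hm,
    inductivelyFree_of_isWeighted_const (isFrame_coordForm ℓ) (isWeighted_braidMulti ℓ m),
    inductivelyFree_of_isWeighted_const (isFrame_coordForm_sumZero ℓ)
      (isWeighted_coxeterAMulti ℓ m), ?_, ?_⟩
  · rintro ⟨k, rfl⟩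
    have h := hasExponents_coxeterAMulti (isPerfectElimination_bot ℓ) fun i j _ => weight_bot k i j
    rwa [eliminationExponents_bot,
      show ℓ * k = (k + k) * ℓ / 2 by
        rw [show (k + k) * ℓ = ℓ * k * 2 by ring, Nat.mul_div_cancel _ two_pos]] at h
  · rintro ⟨k, rfl⟩
    have h := hasExponents_coxeterAMulti (isPerfectElimination_top ℓ)
      fun i j hij => weight_top k hij
    rwa [eliminationExponents_top,
      show ℓ * k = (2 * k + 1 - 1) * ℓ / 2 by
        rw [Nat.add_sub_cancel, show 2 * k * ℓ = ℓ * k * 2 by ring,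
          Nat.mul_div_cancel _ two_pos]] at h
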